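/- Let $F$ be a non-archimedean local field with ring of integers $\mathcal O$ and normalized absolute value $|\cdot|$, let $K=\mathrm{GL}_2(\mathcal O)$, and let $\psi$ be a non-trivial continuous unitary character of $F$. Fix Haar measures $dx$ on $F$, $d^\times x$ on $F^\times$ and $dk$ on $K$. Let $\pi_1,\pi_2$ be irreducible admissible generic representations of $\mathrm{GL}_2(F)$ with central characters $\omega_{\pi_1},\omega_{\pi_2}$ satisfying $\omega_{\pi_1}\omega_{\pi_2}=1$, let $\mathcal W(\pi_i,\psi)$ be their $\psi$-Whittaker models, and let $\mu$ be a quasi-character of $F^\times$. For a Whittaker function $W$, a quasi-character $\chi$ and $s\in\mathbb C$ put $$Z(W,\chi|\cdot|^{s})=\int_{F^\times}W\begin{pmatrix}a&\\&1\end{pmatrix}\chi(a)|a|^{s-\frac12}\,d^\times a ,$$ and for $W_i\in\mathcal W(\pi_i,\psi)$ and a Schwartz–Bruhat (locally constant, compactly supported) function $f$ on $\mathsf M_2(F)\times \mathsf M_2(F)$ put $$\begin{aligned}\mathcal Z(W_1,W_2,f;\mu,|\cdot|^{s_1},|\cdot|^{s_2})=&\int_{u,v\in F}\int_{\epsilon\in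 F^\times}\int_{K^2} f\Big(k_1^{-1}\begin{pmatrix}\epsilon^{-1}&\epsilon^{-1}v\\0&0\end{pmatrix}k_2,\ k_1^{-1}\begin{pmatrix}0&-u\epsilon\\0&\epsilon\end{pmatrix}k_2\Big)\,\omega_{\pi_2}(\epsilon)\mu(\epsilon)^{-2}|\epsilon|^{2s_2-2}\\ &\times\Big(\int_{F^\times}W_1\big(\begin{pmatrix}\alpha&\\&1\end{pmatrix}k_1\big)\psi(u\alpha)\mu(\alpha)|\alpha|^{s_1-\frac12}d^\times\alpha\Big)\Big(\int_{F^\times}W_2\big(\begin{pmatrix}\beta&\\&1\end{pmatrix}k_2\big)\psi(v\beta)\mu^{-1}(\beta)|\beta|^{s_2-\frac12}d^\times\beta\Big)\,du\,dv\,d^\times\epsilon\,dk_1\,dk_2 .\end{aligned}$$ (a) Let $W_1\in\mathcal W(\pi_1,\psi)$ and $W_2\in\mathcal W(\pi_2,\psi)$ be given. The integrals $Z(W_1,\mu|\cdot|^{s})$ and $Z(W_2,\mu^{-1}|\cdot|^{s})$ converge absolutely for $\Re s$ sufficiently large. For every neighbourhood $U$ of the point $\Big(\begin{pmatrix}1&0\\0&0\end{pmatrix},\begin{pmatrix}0&0\\0&1\end{pmatrix}\Big)$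 there is a Schwartz–Bruhat function $f$ with support in $U$, independent of $s_1,s_2$, such that for all $s_1,s_2\in\mathbb C$ for which $Z(W_1,\mu|\cdot|^{s_1})$ and $Z(W_2,\mu^{-1}|\cdot|^{s_2})$ converge absolutely, $\mathcal Z(W_1,W_2,f;\mu,|\cdot|^{s_1},|\cdot|^{s_2})$ converges absolutely (as a multiple integral over $u,v,\epsilon,k_1,k_2,\alpha,\beta$) and $$\mathcal Z(W_1,W_2,f;\mu,|\cdot|^{s_1},|\cdot|^{s_2})=Z(W_1,\mu|\cdot|^{s_1})\,Z(W_2,\mu^{-1}|\cdot|^{s_2}).$$ (b) There are $W_1\in\mathcal W(\pi_1,\psi)$, $W_2\in\mathcal W(\pi_2,\psi)$ and a Schwartz–Bruhat function $f$ such that for all $s_1,s_2\in\mathbb C$ the integral $\mathcal Z(W_1,W_2,f;\mu,|\cdot|^{s_1},|\cdot|^{s_2})$ converges absolutely and equals $1$. -/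

import Mathlib

open MeasureTheory ValuativeRel Topology

noncomputable section

namespace GLTwoZeta

section Group

variable {F : Type*} [Field F]

/-- The matrix `diag(a, 1)`. -/
def diagOne (a : Fˣ) : GL (Fin 2) F :=
  Matrix.GeneralLinearGroup.mkOfDetNeZero !![(a : F), 0; 0, 1] (by simp)

end Group

section Representation

variable {F : Type*} [Field F] [TopologicalSpace F]
variable {V : Type*} [AddCommGroup V] [Module ℂ V]

/-- The space of vectors fixed by an open subgroup. -/
def fixedVectors (π : Representation ℂ (GL (Fin 2) F) V) (U : OpenSubgroup (GL (Fin 2) F)) :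
    Submodule ℂ V where
  carrier := {v | ∀ g ∈ U, π g v = v}
  add_mem' := fun {a b} ha hb g hg => by rw [map_add, ha g hg, hb g hg]
  zero_mem' := fun g _ => map_zero (π g)
  smul_mem' := fun c x hx g hg => by rw [map_smul, hx g hg]

/-- An irreducible admissible (smooth) representation of `GL₂(F)`. -/
structure IsIrredAdmissible (π : Representation ℂ (GL (Fin 2) F) V) : Prop where
  irreducible : π.IsIrreducible
  smooth : ∀ v : V, ∃ U : OpenSubgroup (GL (Fin 2) F), v ∈ fixedVectors π U
  admissible : ∀ U : OpenSubgroup (GL (Fin 2) F), FiniteDimensional ℂ (fixedVectors π U)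

/-- `ω` is the central character of `π`. -/
def IsCentralCharacter (π : Representation ℂ (GL (Fin 2) F) V) (ω : Fˣ →* ℂˣ) : Prop :=
  ∀ (z : Fˣ) (v : V), π (Matrix.GeneralLinearGroup.scalar (Fin 2) z) v = ((ω z : ℂˣ) : ℂ) • v

/-- A `ψ`-Whittaker functional on `π`: `l (π (n x) v) = ψ x * l v`, where `n x` is the upper
triangular unipotent matrix with upper right entry `x`. -/
def IsWhittakerFunctional (π : Representation ℂ (GL (Fin 2) F) V) (ψ : AddChar F Circle)
    (l : V →ₗ[ℂ] ℂ) : Prop :=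
  ∀ (x : F) (v : V), l (π (Matrix.GeneralLinearGroup.upperRightHom x) v) = (ψ x : ℂ) * l v

/-- `π` is generic: it has a non-zero `ψ`-Whittaker functional. -/
def IsGeneric (π : Representation ℂ (GL (Fin 2) F) V) (ψ : AddChar F Circle) : Prop :=
  ∃ l : V →ₗ[ℂ] ℂ, l ≠ 0 ∧ IsWhittakerFunctional π ψ l

/-- The Whittaker model `𝒲(π, ψ)`: the functions `g ↦ l (π g v)`, with `l` a Whittaker functional
and `v` a vector of `π`. -/
def whittakerModel (π : Representation ℂ (GL (Fin 2) F) V) (ψ : AddChar F Circle) :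
    Set (GL (Fin 2) F → ℂ) :=
  {W | ∃ (l : V →ₗ[ℂ] ℂ) (v : V), IsWhittakerFunctional π ψ l ∧ W = fun g => l (π g v)}

end Representation

section LocalField

variable {F : Type*} [Field F] [ValuativeRel F] [TopologicalSpace F]
  [IsNonarchimedeanLocalField F]

/-- The normalized absolute value on `F`: a uniformizer has absolute value `1 / q`, with `q` the
number of elements of the residue field. -/
def normAbs (x : F) : ℝ :=
  (WithZeroMulInt.toNNReal (e := (Nat.card 𝓀[F] : NNReal))
    (by exact_mod_cast Nat.card_pos.ne')
    (IsNonarchimedeanLocalField.valueGroupWithZeroIsoInt F (valuation F x)) : ℝ)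

/-- `|a|^s` as a complex number. -/
def absPow (a : Fˣ) (s : ℂ) : ℂ := (normAbs (a : F) : ℂ) ^ s

variable (F) in
/-- The maximal compact subgroup `K = GL₂(𝒪)`. -/
abbrev maxCompact : Type _ := GL (Fin 2) 𝒪[F]

instance : MeasurableSpace (maxCompact F) := borel _

instance : BorelSpace (maxCompact F) := ⟨rfl⟩

/-- The inclusion of `K` in `GL₂(F)`. -/
def inclK : maxCompact F →* GL (Fin 2) F :=
  Matrix.GeneralLinearGroup.map (algebraMap 𝒪[F] F)

/-- Schwartz–Bruhat functions on `M₂(F) × M₂(F)`. -/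
def IsSchwartzBruhat (f : Matrix (Fin 2) (Fin 2) F × Matrix (Fin 2) (Fin 2) F → ℂ) : Prop :=
  IsLocallyConstant f ∧ HasCompactSupport f

variable (F) in
/-- The base point `(diag(1, 0), diag(0, 1))`. -/
def basePoint : Matrix (Fin 2) (Fin 2) F × Matrix (Fin 2) (Fin 2) F :=
  (!![1, 0; 0, 0], !![0, 0; 0, 1])

/-- The integrand `W(diag(a, 1)) χ(a) |a|^(s - 1/2)` of the zeta integral `Z(W, χ|·|^s)`. -/
def zetaIntegrand (W : GL (Fin 2) F → ℂ) (χ : Fˣ →* ℂˣ) (s : ℂ) (a : Fˣ) : ℂ :=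
  W (diagOne a) * ((χ a : ℂˣ) : ℂ) * absPow a (s - 1 / 2)

/-- The integrand `W(diag(a, 1) k) ψ(u a) χ(a) |a|^(s - 1/2)` of the inner integrals. -/
def innerIntegrand (ψ : AddChar F Circle) (W : GL (Fin 2) F → ℂ) (χ : Fˣ →* ℂˣ) (s : ℂ)
    (u : F) (k : maxCompact F) (a : Fˣ) : ℂ :=
  W (diagOne a * inclK k) * (ψ (u * a) : ℂ) * ((χ a : ℂˣ) : ℂ) * absPow a (s - 1 / 2)

/-- The pair of matrices at which the Schwartz function is evaluated. -/
def orbitPoint (u v : F) (e : Fˣ) (k₁ k₂ : maxCompact F) :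
    Matrix (Fin 2) (Fin 2) F × Matrix (Fin 2) (Fin 2) F :=
  (((inclK k₁)⁻¹ : GL (Fin 2) F).val * !![(e : F)⁻¹, (e : F)⁻¹ * v; 0, 0] * (inclK k₂).val,
   ((inclK k₁)⁻¹ : GL (Fin 2) F).val * !![0, -(u * e); 0, (e : F)] * (inclK k₂).val)

/-- The outer factor `f(⋯) ω(ε) μ(ε)⁻² |ε|^(2 s₂ - 2)`. -/
def outerFactor (f : Matrix (Fin 2) (Fin 2) F × Matrix (Fin 2) (Fin 2) F → ℂ)
    (ω μ : Fˣ →* ℂˣ) (s₂ : ℂ) (u v : F) (e : Fˣ) (k₁ k₂ : maxCompact F) : ℂ :=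
  f (orbitPoint u v e k₁ k₂) * ((ω e : ℂˣ) : ℂ) * (((μ e)⁻¹ ^ 2 : ℂˣ) : ℂ) * absPow e (2 * s₂ - 2)

variable [MeasurableSpace F]

/-- The zeta integral `Z(W, χ|·|^s) = ∫ W(diag(a, 1)) χ(a) |a|^(s - 1/2) d^×a`. -/
def zeta (dm : Measure Fˣ) (W : GL (Fin 2) F → ℂ) (χ : Fˣ →* ℂˣ) (s : ℂ) : ℂ :=
  ∫ a, zetaIntegrand W χ s a ∂dm

/-- Absolute convergence of `Z(W, χ|·|^s)`. -/
def ZetaConverges (dm : Measure Fˣ) (W : GL (Fin 2) F → ℂ) (χ : Fˣ →* ℂˣ) (s : ℂ) : Prop :=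
  Integrable (zetaIntegrand W χ s) dm

/-- The zeta integral in two complex variables, an integral over
`(u, v, ε, k₁, k₂) ∈ F × F × Fˣ × K × K`. Here `ω` is the central character of the representation
to which `W₂` belongs. -/
def zetaTwo (dx : Measure F) (dm : Measure Fˣ) (dk : Measure (maxCompact F))
    (ψ : AddChar F Circle) (ω : Fˣ →* ℂˣ) (W₁ W₂ : GL (Fin 2) F → ℂ)
    (f : Matrix (Fin 2) (Fin 2) F × Matrix (Fin 2) (Fin 2) F → ℂ)
    (μ : Fˣ →* ℂˣ) (s₁ s₂ : ℂ) : ℂ :=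
  ∫ p : F × F × Fˣ × maxCompact F × maxCompact F,
    (match p with
      | (u, v, e, k₁, k₂) =>
        outerFactor f ω μ s₂ u v e k₁ k₂ *
          (∫ a, innerIntegrand ψ W₁ μ s₁ u k₁ a ∂dm) *
          (∫ b, innerIntegrand ψ W₂ μ⁻¹ s₂ v k₂ b ∂dm))
    ∂(dx.prod (dx.prod (dm.prod (dk.prod dk))))

/-- Absolute convergence of the zeta integral in two complex variables, as a multiple integral over
all the variables `(u, v, ε, k₁, k₂, α, β)`. -/
def ZetaTwoConverges (dx : Measure F) (dm : Measure Fˣ) (dk : Measure (maxCompact F))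
    (ψ : AddChar F Circle) (ω : Fˣ →* ℂˣ) (W₁ W₂ : GL (Fin 2) F → ℂ)
    (f : Matrix (Fin 2) (Fin 2) F × Matrix (Fin 2) (Fin 2) F → ℂ)
    (μ : Fˣ →* ℂˣ) (s₁ s₂ : ℂ) : Prop :=
  Integrable
    (fun p : (F × F × Fˣ × maxCompact F × maxCompact F) × Fˣ × Fˣ =>
      match p with
      | ((u, v, e, k₁, k₂), a, b) =>
        outerFactor f ω μ s₂ u v e k₁ k₂ *
          innerIntegrand ψ W₁ μ s₁ u k₁ a * innerIntegrand ψ W₂ μ⁻¹ s₂ v k₂ b)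
    ((dx.prod (dx.prod (dm.prod (dk.prod dk)))).prod (dm.prod dm))

end LocalField

end GLTwoZeta

end

/-! The test function is a multiple of the indicator of `nearBase r`, a small ball around the base
point. If the orbit point of (u, v, ε, k₁, k₂) lies in this ball, then k₁ and k₂ are upper
triangular modulo the radius, u and v are close to the values -b/d read off from k₁ and k₂ (k = [a,
b; c, d]), and ε is a unit (`orbitPoint_mem_nearBase`).

Factor such a k as n(b/d) · d · diag(t, 1) · k', with t = det k / d² and k' lower unipotent close to
1. The vector is fixed by k', the scalar d acts through the central character, and the remaining
factor ψ(α(u + b/d)) equals 1 wherever the Whittaker function does not vanish. Hence each inner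
integrand is a constant times a translate of the integrand of the zeta integral
(`innerIntegrand_eq`). The two constants cancel the characters of the outer factor, because ω₁ω₂ = 1
while εd₂/d₁ and det k₁ / det k₂ are close to 1 (`exists_inner_translates`). Haar invariance removes
the translations, which leaves the volume of the parameter set times the product of zeta integrals
(`zetaTwo_indicator_nearBase`). That volume is positive and finite (`measure_nearParam_pos`), so the
indicator can be normalized, independently of s₁ and s₂. The same computation with absolute values
gives absolute convergence.

Convergence of the zeta integrals for large Re s has two halves. The Whittaker function vanishes for
large |a| because ψ is non-trivial (`IsFixed.whittaker_eq_zero`). Near zero, an averaging operator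
on a finite-dimensional space of fixed vectors realizes the shift a ↦ aϖ, so growth along the shells
|a| ~ |ϖ|ⁿ is at most geometric (`exists_whittaker_growth`).

For (b), a finite Fourier sum over unipotent translates yields a Whittaker function that on the
torus is a constant multiple of the indicator of a small neighbourhood of 1, on which μ and |·| are
trivial (`exists_zeta_eq_one`). Its zeta integral is the same for every s, and (a) applies. -/

noncomputable section

namespace GLTwoZeta

open Matrix.GeneralLinearGroup (upperRightHom)

set_option linter.unusedSectionVars false

/-! ### The normalized absolute value and the ultrametric inequality. -/

section NormAbs

variable {F : Type*} [Field F] [ValuativeRel F] [TopologicalSpace F]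
  [IsNonarchimedeanLocalField F]

variable (F) in
lemma one_lt_card_residueField : (1 : NNReal) < (Nat.card 𝓀[F] : NNReal) := by
  exact_mod_cast Finite.one_lt_card

lemma normAbs_def (x : F) : normAbs x =
    (WithZeroMulInt.toNNReal (zero_lt_one.trans (one_lt_card_residueField F)).ne'
      (IsNonarchimedeanLocalField.valueGroupWithZeroIsoInt F (valuation F x)) : ℝ) := rfl

/-- Since q > 1, the passage from valuations to real numbers is strictly increasing; the ultrametric
inequality and the description of 𝒪 are inherited through this. -/
lemma normAbs_le_iff {x y : F} : normAbs x ≤ normAbs y ↔ valuation F x ≤ valuation F y := by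
  rw [normAbs_def, normAbs_def, NNReal.coe_le_coe,
    (WithZeroMulInt.toNNReal_strictMono (one_lt_card_residueField F)).le_iff_le]
  exact OrderIsoClass.map_le_map_iff _

@[simp] lemma normAbs_zero : normAbs (0 : F) = 0 := by simp [normAbs_def]

@[simp] lemma normAbs_one : normAbs (1 : F) = 1 := by simp [normAbs_def]

@[simp] lemma normAbs_mul (x y : F) : normAbs (x * y) = normAbs x * normAbs y := by
  simp [normAbs_def]

lemma normAbs_nonneg (x : F) : 0 ≤ normAbs x := NNReal.coe_nonneg _

@[simp] lemma normAbs_neg (x : F) : normAbs (-x) = normAbs x := by simp [normAbs_def]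

@[simp] lemma normAbs_inv (x : F) : normAbs x⁻¹ = (normAbs x)⁻¹ := by simp [normAbs_def]

@[simp] lemma normAbs_div (x y : F) : normAbs (x / y) = normAbs x / normAbs y := by
  simp [div_eq_mul_inv]

@[simp] lemma normAbs_pow (x : F) (n : ℕ) : normAbs (x ^ n) = normAbs x ^ n := by
  simp [normAbs_def]

lemma normAbs_pos {x : F} (hx : x ≠ 0) : 0 < normAbs x := by
  rw [normAbs_def, NNReal.coe_pos]
  exact WithZeroMulInt.toNNReal_pos _ (by simpa using hx)

lemma normAbs_unit_pos (x : Fˣ) : 0 < normAbs (x : F) := normAbs_pos x.ne_zero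

@[simp] lemma normAbs_eq_zero {x : F} : normAbs x = 0 ↔ x = 0 :=
  ⟨fun h => by_contra fun hx => (normAbs_pos hx).ne' h, fun h => by simp [h]⟩

lemma normAbs_le_one_iff {x : F} : normAbs x ≤ 1 ↔ x ∈ 𝒪[F] := by
  rw [← normAbs_one (F := F), normAbs_le_iff, map_one, Valuation.mem_integer_iff]

lemma normAbs_add_le_max (x y : F) : normAbs (x + y) ≤ max (normAbs x) (normAbs y) := by
  rcases (valuation F).map_add' x y with h | h
  · exact le_max_of_le_left (normAbs_le_iff.2 h)
  · exact le_max_of_le_right (normAbs_le_iff.2 h)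

lemma normAbs_add_le {x y : F} {r : ℝ} (hx : normAbs x ≤ r) (hy : normAbs y ≤ r) :
    normAbs (x + y) ≤ r := (normAbs_add_le_max x y).trans (max_le hx hy)

lemma normAbs_sub_le {x y : F} {r : ℝ} (hx : normAbs x ≤ r) (hy : normAbs y ≤ r) :
    normAbs (x - y) ≤ r := by
  rw [sub_eq_add_neg]; exact normAbs_add_le hx (by simpa using hy)

/-- If `y` is closer to `x` than `x` is to zero, then `y` has the same absolute value as `x`. -/
lemma normAbs_eq_of_sub_lt {x y : F} (h : normAbs (y - x) < normAbs x) :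
    normAbs y = normAbs x := by
  apply le_antisymm
  · simpa using normAbs_add_le (x := y - x) (y := x) h.le le_rfl
  · by_contra! hlt
    have := normAbs_add_le_max y (-(y - x))
    rw [show y + -(y - x) = x by ring, normAbs_neg] at this
    exact (this.trans_lt (max_lt hlt h)).false

lemma normAbs_mul_le {x y : F} {r s : ℝ} (hx : normAbs x ≤ r) (hy : normAbs y ≤ s) :
    normAbs (x * y) ≤ r * s := by
  rw [normAbs_mul]
  exact mul_le_mul hx hy (normAbs_nonneg _) ((normAbs_nonneg _).trans hx)

lemma normAbs_integer (x : 𝒪[F]) : normAbs (x : F) ≤ 1 := normAbs_le_one_iff.2 x.2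

variable (F) in
/-- There is a uniformizer: an element `ϖ` such that every absolute value is a power of `|ϖ|`. -/
lemma exists_uniformizer : ∃ ϖ : Fˣ, normAbs (ϖ : F) < 1 ∧
    ∀ x : Fˣ, ∃ n : ℤ, normAbs (x : F) = normAbs (ϖ : F) ^ n := by
  let e := IsNonarchimedeanLocalField.valueGroupWithZeroIsoInt F
  obtain ⟨p, hp⟩ := ValuativeRel.valuation_surjective (e.symm (WithZero.exp (-1)))
  have hp' : e (valuation F p) = WithZero.exp (-1) := by rw [hp]; simp
  have hp0 : p ≠ 0 := by
    rintro rfl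
    rw [map_zero, map_zero] at hp'
    exact WithZero.exp_ne_zero hp'.symm
  have key : ∀ x : Fˣ, ∃ n : ℤ, normAbs (x : F) = normAbs p ^ n := by
    intro x
    -- The element `p` has logarithm -1, whence the sign.
    refine ⟨-(WithZero.log (e (valuation F (x : F)))), ?_⟩
    have : e (valuation F (x : F)) =
        e (valuation F p) ^ (-(WithZero.log (e (valuation F (x : F))))) := by
      rw [hp', ← WithZero.exp_zsmul]
      simp [WithZero.exp_log]
    rw [normAbs_def, normAbs_def]
    change ((WithZeroMulInt.toNNReal _ (e (valuation F (x : F))) : NNReal) : ℝ)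
      = ((WithZeroMulInt.toNNReal _ (e (valuation F p)) : NNReal) : ℝ) ^ _
    rw [this, map_zpow₀]
    simp [← this]
  refine ⟨Units.mk0 p hp0, ?_, key⟩
  rw [normAbs_def]
  change ((WithZeroMulInt.toNNReal _ (e (valuation F p)) : NNReal) : ℝ) < 1
  rw [hp']
  rw [NNReal.coe_lt_one, WithZeroMulInt.toNNReal_lt_one_iff (one_lt_card_residueField F),
    ← WithZero.exp_zero, WithZero.exp_lt_exp]
  norm_num

end NormAbs

/-! ### Balls, compactness and countability of the spaces involved. -/

section Topology

variable {F : Type*} [Field F] [ValuativeRel F] [TopologicalSpace F]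
  [IsNonarchimedeanLocalField F]

variable (F) in
lemma hasBasis_nhds_zero_normAbs :
    (𝓝 (0 : F)).HasBasis (fun r : ℝ => 0 < r) fun r => {x | normAbs x ≤ r} := by
  obtain ⟨ϖ, hϖ, -⟩ := exists_uniformizer F
  refine (IsValuativeTopology.hasBasis_nhds_zero' F).to_hasBasis ?_ ?_
  · intro γ hγ
    obtain ⟨y, rfl⟩ := ValuativeRel.valuation_surjective γ
    have hy : y ≠ 0 := by rintro rfl; simp at hγ
    refine ⟨normAbs (ϖ * y : F), normAbs_pos (mul_ne_zero ϖ.ne_zero hy), fun x hx => ?_⟩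
    show valuation F x < valuation F y
    refine lt_of_not_ge fun h => ?_
    have h1 : normAbs y ≤ normAbs x := normAbs_le_iff.2 h
    have h2 := h1.trans hx
    rw [normAbs_mul] at h2
    nlinarith [normAbs_pos hy]
  · intro r hr
    obtain ⟨n, hn⟩ := exists_pow_lt_of_lt_one hr hϖ
    refine ⟨valuation F ((ϖ : F) ^ n), by simp, fun x hx => ?_⟩
    have h1 : normAbs x ≤ normAbs ((ϖ : F) ^ n) := normAbs_le_iff.2 (le_of_lt hx)
    exact h1.trans ((normAbs_pow _ n).trans_le hn.le)

variable (F) in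
/-- The closed ball of radius `r` about zero, an additive subgroup of `F`. -/
def ball (r : NNReal) : AddSubgroup F where
  carrier := {x | normAbs x ≤ r}
  add_mem' := normAbs_add_le
  zero_mem' := by simp
  neg_mem' := by simp

lemma mem_ball {r : NNReal} {x : F} : x ∈ ball F r ↔ normAbs x ≤ r := Iff.rfl

lemma isOpen_ball {r : NNReal} (hr : 0 < r) : IsOpen (ball F r : Set F) :=
  AddSubgroup.isOpen_of_mem_nhds _ (g := 0)
    ((hasBasis_nhds_zero_normAbs F).mem_of_mem (NNReal.coe_pos.2 hr))

lemma isCompact_ball (r : NNReal) : IsCompact (ball F r : Set F) := by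
  obtain ⟨ϖ, hϖ, -⟩ := exists_uniformizer F
  obtain ⟨y, hy⟩ : ∃ y : F, (r : ℝ) ≤ normAbs y := by
    obtain ⟨m, hm⟩ := pow_unbounded_of_one_lt (r : ℝ)
      ((one_lt_inv₀ (normAbs_unit_pos ϖ)).2 hϖ)
    refine ⟨((ϖ : F)⁻¹) ^ m, ?_⟩
    rw [normAbs_pow, normAbs_inv]
    exact hm.le
  -- Radius zero is separate: that ball is a point, whereas the others are closed because they are
  -- open subgroups.
  rcases eq_or_lt_of_le (zero_le (a := r)) with h0 | h0
  · have : (ball F r : Set F) = {0} := by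
      subst h0
      ext x
      simp only [SetLike.mem_coe, mem_ball, Set.mem_singleton_iff, NNReal.coe_zero]
      exact ⟨fun h => normAbs_eq_zero.1 (h.antisymm (normAbs_nonneg x)), fun h => by simp [h]⟩
    rw [this]; exact isCompact_singleton
  · refine (IsNonarchimedeanLocalField.isCompact_closedBall F (valuation F y)).of_isClosed_subset
      (AddSubgroup.isClosed_of_isOpen _ (isOpen_ball h0)) fun x hx => ?_
    exact normAbs_le_iff.1 (le_trans hx hy)

/-- Second countability makes the Borel structure of the products over which the multiple integrals
run the product one. A rank-one valuation turns F into a proper normed field, which gives it. -/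
instance : SecondCountableTopology F := by
  let := IsTopologicalAddGroup.rightUniformSpace F
  have := isUniformAddGroup_of_addCommGroup (G := F)
  let : (Valued.v (R := F)).RankOne :=
  { hom' := IsRankLeOne.nonempty.some.emb (R := F).comp MonoidWithZeroHom.ValueGroup₀.embedding
    strictMono' := IsRankLeOne.nonempty.some.strictMono.comp
        MonoidWithZeroHom.ValueGroup₀.embedding_strictMono }
  open scoped Valued in
  have : ProperSpace F := .of_nontriviallyNormedField_of_weaklyLocallyCompactSpace F
  infer_instance

instance : T2Space F := by
  let := IsTopologicalAddGroup.rightUniformSpace F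
  have := isUniformAddGroup_of_addCommGroup (G := F)
  infer_instance

instance : SecondCountableTopology Fˣ :=
  Units.isEmbedding_val₀.secondCountableTopology

instance : SecondCountableTopology (maxCompact F) := by
  have : SecondCountableTopology 𝒪[F] := 
    IsEmbedding.subtypeVal.secondCountableTopology
  have : SecondCountableTopology (Matrix (Fin 2) (Fin 2) 𝒪[F]) :=
    inferInstanceAs (SecondCountableTopology (Fin 2 → Fin 2 → 𝒪[F]))
  have : SecondCountableTopology (Matrix (Fin 2) (Fin 2) 𝒪[F])ᵐᵒᵖ :=
    MulOpposite.opHomeomorph.symm.isEmbedding.secondCountableTopology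
  exact Units.isEmbedding_embedProduct.secondCountableTopology

instance : CompactSpace (maxCompact F) := by
  have : T1Space (Matrix (Fin 2) (Fin 2) 𝒪[F]) := inferInstanceAs (T1Space (Fin 2 → Fin 2 → 𝒪[F]))
  have : CompactSpace (Matrix (Fin 2) (Fin 2) 𝒪[F]) :=
    inferInstanceAs (CompactSpace (Fin 2 → Fin 2 → 𝒪[F]))
  infer_instance

/-- In a topological field with continuous inversion the units carry the subspace topology, so both
structures are pulled back along `Units.val`. -/
instance [MeasurableSpace F] [BorelSpace F] : BorelSpace Fˣ :=
  ⟨by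
    have h : borel Fˣ = MeasurableSpace.comap Units.val (borel F) := by
      rw [Units.isEmbedding_val₀.eq_induced]
      exact borel_comap (f := Units.val)
    rw [h, ← BorelSpace.measurable_eq (α := F)]
    rfl⟩

lemma continuous_inclK : Continuous (inclK (F := F)) := by
  refine Continuous.units_map _ ?_
  refine continuous_matrix fun i j => ?_
  exact continuous_subtype_val.comp (Continuous.matrix_elem continuous_id i j)

end Topology

/-! ### Finite systems of coset representatives. -/

section CosetReps

variable {A : Type*} [AddCommGroup A]

/-- `X` is a finite set of representatives for the cosets of `L'` in `L`. -/
structure IsCosetReps (X : Finset A) (L L' : AddSubgroup A) : Prop where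
  mem : ∀ x ∈ X, x ∈ L
  existsUnique : ∀ z ∈ L, ∃! x, x ∈ X ∧ z - x ∈ L'

lemma IsCosetReps.nonempty {X : Finset A} {L L' : AddSubgroup A} (hX : IsCosetReps X L L') :
    X.Nonempty := by
  obtain ⟨x, hx, -⟩ := hX.existsUnique 0 L.zero_mem
  exact ⟨x, hx.1⟩

/-- Sums over coset representatives are translation invariant. -/
lemma IsCosetReps.sum_add {X : Finset A} {L L' : AddSubgroup A} (hX : IsCosetReps X L L')
    {M : Type*} [AddCommMonoid M] {f : A → M} (hf : ∀ x ∈ L, ∀ y ∈ L', f (x + y) = f x)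
    {y : A} (hy : y ∈ L) : ∑ x ∈ X, f (x + y) = ∑ x ∈ X, f x := by
  have h : ∀ z : L, ∃ x, (x ∈ X ∧ (z : A) - x ∈ L') ∧ ∀ x', (x' ∈ X ∧ (z : A) - x' ∈ L') → x' = x :=
    fun z => hX.existsUnique z z.2
  choose i hi hu using h
  -- The bijection sends x to the representative of the coset of x + y.
  refine Finset.sum_bij (fun x hx => i ⟨x + y, L.add_mem (hX.mem x hx) hy⟩)
    (fun x hx => (hi _).1) ?_ ?_ ?_
  · intro x hx x' hx' he
    have h1 := (hi ⟨x + y, L.add_mem (hX.mem x hx) hy⟩).2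
    have h2 := (hi ⟨x' + y, L.add_mem (hX.mem x' hx') hy⟩).2
    rw [← he] at h2
    have h3 : x - x' ∈ L' := by
      have := L'.sub_mem h1 h2
      simpa using this
    rw [hu ⟨x, hX.mem x hx⟩ x ⟨hx, by simp⟩, hu ⟨x, hX.mem x hx⟩ x' ⟨hx', h3⟩]
  · intro b hb
    have hb' : b - y ∈ L := L.sub_mem (hX.mem b hb) hy
    have h1 := hi ⟨b - y, hb'⟩
    refine ⟨i ⟨b - y, hb'⟩, h1.1, ?_⟩
    refine (hu _ b ⟨hb, ?_⟩).symm
    have := L'.neg_mem h1.2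
    convert this using 1
    simp only
    abel
  · intro x hx
    have h1 := hi ⟨x + y, L.add_mem (hX.mem x hx) hy⟩
    rw [← hf _ (hX.mem _ h1.1) _ h1.2]
    congr 1
    simp

/-- An open subgroup of a compact group has finite index; choose one element in each coset. -/
lemma exists_isCosetReps [TopologicalSpace A] [IsTopologicalAddGroup A] {L L' : AddSubgroup A}
    (hL : IsCompact (L : Set A)) (hL' : IsOpen (L' : Set A)) :
    ∃ X : Finset A, IsCosetReps X L L' := by
  classical
  have : CompactSpace L := isCompact_iff_compactSpace.1 hL
  have hfin : Finite (L ⧸ L'.addSubgroupOf L) :=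
    AddSubgroup.quotient_finite_of_isOpen _ (hL'.preimage continuous_subtype_val)
  have := Fintype.ofFinite (L ⧸ L'.addSubgroupOf L)
  have key : ∀ (z : L) (q : L ⧸ L'.addSubgroupOf L),
      (z : A) - (q.out : L) ∈ L' ↔ (z : L ⧸ L'.addSubgroupOf L) = q := by
    intro z q
    conv_rhs => rw [← QuotientAddGroup.out_eq' q]
    rw [eq_comm, QuotientAddGroup.eq, AddSubgroup.mem_addSubgroupOf]
    simp [sub_eq_add_neg, add_comm]
  refine ⟨Finset.univ.image fun q : L ⧸ L'.addSubgroupOf L => ((q.out : L) : A), ?_, ?_⟩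
  · intro x hx
    obtain ⟨q, -, rfl⟩ := Finset.mem_image.1 hx
    exact q.out.2
  · intro z hz
    refine ⟨(((⟨z, hz⟩ : L) : L ⧸ L'.addSubgroupOf L).out : L), ⟨?_, ?_⟩, ?_⟩
    · exact Finset.mem_image_of_mem (fun q : L ⧸ L'.addSubgroupOf L => ((q.out : L) : A))
        (Finset.mem_univ _)
    · exact (key ⟨z, hz⟩ _).2 rfl
    · rintro x ⟨hx, hzx⟩
      obtain ⟨q, -, rfl⟩ := Finset.mem_image.1 hx
      rw [(key ⟨z, hz⟩ q).1 hzx]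

end CosetReps

/-! ### Absence of small subgroups in ℂˣ. -/

section SmallSubgroups

/-- The disc about `1` of radius `1/2` contains no nontrivial subgroup of `ℂˣ`. -/
lemma eq_one_of_forall_norm_pow_sub_one_le {z : ℂ} (h : ∀ n : ℕ, ‖z ^ n - 1‖ ≤ 1 / 2) : z = 1 := by
  by_contra hz
  have hpos : 0 < ‖z - 1‖ := norm_pos_iff.2 (sub_ne_zero.2 hz)
  -- Squaring multiplies the distance to 1 by |z + 1| ≥ 3/2, so a point other than 1 eventually
  -- leaves the disc.
  have key : ∀ k : ℕ, (3 / 2 : ℝ) ^ k * ‖z - 1‖ ≤ ‖z ^ (2 ^ k) - 1‖ := by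
    intro k
    induction k with
    | zero => simp
    | succ k ih =>
      have h1 : z ^ (2 ^ (k + 1)) - 1 = (z ^ (2 ^ k) - 1) * (z ^ (2 ^ k) + 1) := by ring
      have h2 : (3 / 2 : ℝ) ≤ ‖z ^ (2 ^ k) + 1‖ := by
        have h3 := h (2 ^ k)
        have h4 : ‖(2 : ℂ)‖ ≤ ‖z ^ (2 ^ k) + 1‖ + ‖z ^ (2 ^ k) - 1‖ := by
          have := norm_sub_le (z ^ (2 ^ k) + 1) (z ^ (2 ^ k) - 1)
          rwa [show z ^ (2 ^ k) + 1 - (z ^ (2 ^ k) - 1) = (2 : ℂ) by ring] at this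
        rw [Complex.norm_ofNat] at h4
        linarith
      rw [h1, norm_mul, pow_succ]
      calc (3 / 2 : ℝ) ^ k * (3 / 2) * ‖z - 1‖ = ((3 / 2 : ℝ) ^ k * ‖z - 1‖) * (3 / 2) := by ring
        _ ≤ _ := mul_le_mul ih h2 (by norm_num) (norm_nonneg _)
  obtain ⟨k, hk⟩ := pow_unbounded_of_one_lt (1 / ‖z - 1‖) (by norm_num : (1 : ℝ) < 3 / 2)
  have := (key k).trans (h _)
  rw [div_lt_iff₀ hpos] at hk
  linarith

end SmallSubgroups

/-! ### Neighbourhoods in terms of the absolute value; characters are trivial near the identity. -/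

section Nhds

variable {F : Type*} [Field F] [ValuativeRel F] [TopologicalSpace F]
  [IsNonarchimedeanLocalField F]

lemma exists_normAbs_subset {x : F} {s : Set F} (hs : s ∈ 𝓝 x) :
    ∃ r : NNReal, 0 < r ∧ ∀ y, normAbs (y - x) ≤ r → y ∈ s := by
  have h : Filter.Tendsto (fun y : F => y + x) (𝓝 0) (𝓝 x) := by
    have := (continuous_add_const x).tendsto (0 : F)
    rwa [zero_add] at this
  obtain ⟨r, hr, hrs⟩ := (hasBasis_nhds_zero_normAbs F).mem_iff.1 (h hs)
  refine ⟨⟨r, hr.le⟩, hr, fun y hy => ?_⟩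
  have := hrs (show y - x ∈ {x | normAbs x ≤ r} from hy)
  simpa using this

lemma exists_normAbs_matrix_subset {M : Matrix (Fin 2) (Fin 2) F}
    {s : Set (Matrix (Fin 2) (Fin 2) F)} (hs : s ∈ 𝓝 M) :
    ∃ r : NNReal, 0 < r ∧ ∀ N : Matrix (Fin 2) (Fin 2) F,
      (∀ i j, normAbs (N i j - M i j) ≤ r) → N ∈ s := by
  have hs' : s ∈ Filter.pi fun i => Filter.pi fun j => 𝓝 (M i j) := by
    have : 𝓝 M = Filter.pi fun i => Filter.pi fun j => 𝓝 (M i j) := by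
      have h1 : 𝓝 M = Filter.pi fun i => 𝓝 (M i) := nhds_pi
      rw [h1]
      congr 1
      funext i
      exact nhds_pi
    rwa [this] at hs
  obtain ⟨I, -, t, ht, hts⟩ := Filter.mem_pi.1 hs'
  have h2 : ∀ i, ∃ u : Fin 2 → Set F, (∀ j, u j ∈ 𝓝 (M i j)) ∧ Set.univ.pi u ⊆ t i := by
    intro i
    obtain ⟨J, -, u, hu, hut⟩ := Filter.mem_pi.1 (ht i)
    exact ⟨u, hu, (Set.pi_mono' (fun _ _ => subset_rfl) (Set.subset_univ _)).trans hut⟩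
  choose u hu hut using h2
  choose r hr hru using fun i j => exists_normAbs_subset (hu i j)
  refine ⟨min (min (r 0 0) (r 0 1)) (min (r 1 0) (r 1 1)), by simp [hr], fun N hN => ?_⟩
  refine hts fun i _ => hut i fun j _ => hru i j _ ((hN i j).trans ?_)
  rw [NNReal.coe_le_coe]
  fin_cases i <;> fin_cases j <;> simp

lemma exists_normAbs_units_subset {s : Set Fˣ} (hs : s ∈ 𝓝 (1 : Fˣ)) :
    ∃ r : NNReal, 0 < r ∧ ∀ y : Fˣ, normAbs ((y : F) - 1) ≤ r → y ∈ s := by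
  rw [Units.isEmbedding_val₀.nhds_eq_comap] at hs
  obtain ⟨t, ht, hts⟩ := hs
  obtain ⟨r, hr, hrt⟩ := exists_normAbs_subset ht
  exact ⟨r, hr, fun y hy => hts (hrt _ (by simpa using hy))⟩

lemma normAbs_eq_one_of_sub_one_le {x : F} {r : NNReal} (hr : r < 1) (h : normAbs (x - 1) ≤ r) :
    normAbs x = 1 := by
  have := normAbs_eq_of_sub_lt (x := 1) (y := x)
    (by rw [normAbs_one]; exact h.trans_lt (by exact_mod_cast hr))
  simpa using this

lemma normAbs_le_one_of_sub_one_le {x : F} {r : NNReal} (hr : r < 1) (h : normAbs (x - 1) ≤ r) :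
    normAbs x ≤ 1 := (normAbs_eq_one_of_sub_one_le hr h).le

lemma normAbs_det_sub_one_le {r : NNReal} (hr : r < 1) {M : Matrix (Fin 2) (Fin 2) F}
    (h : ∀ i j, normAbs (M i j - (1 : Matrix (Fin 2) (Fin 2) F) i j) ≤ r) :
    normAbs (M.det - 1) ≤ r := by
  have hr1 : (r : ℝ) ≤ 1 := by exact_mod_cast hr.le
  have ha : normAbs (M 0 0 - 1) ≤ r := by simpa using h 0 0
  have hb : normAbs (M 0 1) ≤ r := by simpa using h 0 1
  have hc : normAbs (M 1 0) ≤ r := by simpa using h 1 0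
  have hd : normAbs (M 1 1 - 1) ≤ r := by simpa using h 1 1
  rw [Matrix.det_fin_two, show M 0 0 * M 1 1 - M 0 1 * M 1 0 - 1 =
    M 0 0 * (M 1 1 - 1) + (M 0 0 - 1) - M 0 1 * M 1 0 by ring]
  refine normAbs_sub_le (normAbs_add_le ?_ ha) ?_
  · simpa using normAbs_mul_le (normAbs_le_one_of_sub_one_le hr ha) hd
  · simpa using normAbs_mul_le (hb.trans hr1) hc

/-- A continuous additive character is trivial near zero. -/
lemma exists_addChar_eq_one {ψ : AddChar F Circle} (hψ : Continuous ψ) :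
    ∃ r : NNReal, 0 < r ∧ ∀ x : F, normAbs x ≤ r → ψ x = 1 := by
  have hs : {x : F | ‖(ψ x : ℂ) - 1‖ ≤ 1 / 2} ∈ 𝓝 (0 : F) := by
    have hc : Continuous fun x : F => ‖(ψ x : ℂ) - 1‖ := by fun_prop
    have := hc.tendsto 0
    simp only [AddChar.map_zero_eq_one, Circle.coe_one, sub_self, norm_zero] at this
    exact this (Iic_mem_nhds (by norm_num))
  obtain ⟨r, hr, h⟩ := exists_normAbs_subset hs
  refine ⟨r, hr, fun x hx => ?_⟩
  apply Circle.coe_injective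
  rw [Circle.coe_one]
  refine eq_one_of_forall_norm_pow_sub_one_le fun n => ?_
  -- The ball is a subgroup, so all powers of ψ x stay in the disc.
  have : n • x ∈ ball F r := (ball F r).nsmul_mem hx n
  have h2 := h (n • x) (by rwa [sub_zero])
  rw [Set.mem_ofPred_eq, AddChar.map_nsmul_eq_pow] at h2
  simpa using h2

/-- A quasi-character is trivial near one. -/
lemma exists_char_eq_one {μ : Fˣ →* ℂˣ} (hμ : Continuous μ) :
    ∃ r : NNReal, 0 < r ∧ ∀ x : Fˣ, normAbs ((x : F) - 1) ≤ r → μ x = 1 := by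
  have hs : {x : Fˣ | ‖(μ x : ℂ) - 1‖ ≤ 1 / 2} ∈ 𝓝 (1 : Fˣ) := by
    have hc : Continuous fun x : Fˣ => ‖(μ x : ℂ) - 1‖ :=
      ((Units.continuous_val.comp hμ).sub continuous_const).norm
    have := hc.tendsto 1
    simp only [map_one, Units.val_one, sub_self, norm_zero] at this
    exact this (Iic_mem_nhds (by norm_num))
  obtain ⟨r, hr, h⟩ := exists_normAbs_units_subset hs
  -- Radius at most 1 keeps x integral, which the induction on powers needs.
  refine ⟨min r 1, by simp [hr], fun x hx => ?_⟩
  have hx1 : normAbs ((x : F) - 1) ≤ 1 := hx.trans (by simp)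
  have hxr : normAbs ((x : F) - 1) ≤ r := hx.trans (by simp)
  have hx' : normAbs (x : F) ≤ 1 := by
    have := normAbs_add_le (x := (x : F) - 1) (y := 1) (r := 1) hx1 (by simp)
    simpa using this
  apply Units.ext
  rw [Units.val_one]
  refine eq_one_of_forall_norm_pow_sub_one_le fun n => ?_
  have hn : normAbs ((x : F) ^ n - 1) ≤ r := by
    induction n with
    | zero => simp
    | succ n ih =>
      rw [show (x : F) ^ (n + 1) - 1 = (x : F) * ((x : F) ^ n - 1) + ((x : F) - 1) by ring]
      refine normAbs_add_le ?_ hxr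
      simpa using normAbs_mul_le hx' ih
  have := h (x ^ n) (by simpa using hn)
  simpa using this

end Nhds

/-! ### Principal congruence subgroups of GL₂(F). -/

section Congruence

variable {F : Type*} [Field F] [ValuativeRel F] [TopologicalSpace F]
  [IsNonarchimedeanLocalField F]

/-- A `2 × 2` matrix congruent to the identity modulo the ball of radius `r`. -/
def NearOne (r : NNReal) (g : GL (Fin 2) F) : Prop :=
  ∀ i j, normAbs (g.val i j - (1 : Matrix (Fin 2) (Fin 2) F) i j) ≤ r

lemma nearOne_iff {r : NNReal} {g : GL (Fin 2) F} : NearOne r g ↔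
    normAbs (g.val 0 0 - 1) ≤ r ∧ normAbs (g.val 0 1) ≤ r ∧ normAbs (g.val 1 0) ≤ r ∧
      normAbs (g.val 1 1 - 1) ≤ r := by
  simp [NearOne, Fin.forall_fin_two, and_assoc]

/-- The determinant is itself within r of 1, hence a unit, and the inverse is the adjugate divided
by it. -/
lemma NearOne.inv {r : NNReal} (hr : r < 1) {g : GL (Fin 2) F} (hg : NearOne r g) :
    NearOne r g⁻¹ := by
  obtain ⟨ha, hb, hc, hd⟩ := nearOne_iff.1 hg
  have hdet : normAbs (g.val.det - 1) ≤ r := normAbs_det_sub_one_le hr hg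
  have hdet1 := normAbs_eq_one_of_sub_one_le hr hdet
  have hdet0 : g.val.det ≠ 0 := by
    intro h; rw [h] at hdet1; simp at hdet1
  have hinv : (g⁻¹).val = g.val.det⁻¹ • !![g.val 1 1, -g.val 0 1; -g.val 1 0, g.val 0 0] := by
    rw [Matrix.coe_units_inv, Matrix.inv_def, Matrix.adjugate_fin_two, Ring.inverse_eq_inv']
  have key : ∀ x : F, normAbs (x - 1) ≤ r → normAbs (g.val.det⁻¹ * x - 1) ≤ r := by
    intro x hx
    rw [show g.val.det⁻¹ * x - 1 = g.val.det⁻¹ * ((x - 1) - (g.val.det - 1)) by field_simp; ring,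
      normAbs_mul, normAbs_inv, hdet1, inv_one, one_mul]
    exact normAbs_sub_le hx hdet
  rw [nearOne_iff, hinv]
  refine ⟨?_, ?_, ?_, ?_⟩
  · simpa using key _ hd
  · simpa [hdet1] using hb
  · simpa [hdet1] using hc
  · simpa using key _ ha

lemma NearOne.mul {r : NNReal} (hr : r < 1) {g h : GL (Fin 2) F} (hg : NearOne r g)
    (hh : NearOne r h) : NearOne r (g * h) := by
  have hr1 : (r : ℝ) ≤ 1 := by exact_mod_cast hr.le
  intro i j
  have h1 : (g * h).val i j - (1 : Matrix (Fin 2) (Fin 2) F) i j =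
      ((g.val - 1) * (h.val - 1)) i j + (g.val i j - (1 : Matrix (Fin 2) (Fin 2) F) i j) +
        (h.val i j - (1 : Matrix (Fin 2) (Fin 2) F) i j) := by
    have hm : g.val * h.val - 1 = (g.val - 1) * (h.val - 1) + (g.val - 1) + (h.val - 1) := by
      noncomm_ring
    exact congrFun (congrFun hm i) j
  rw [h1]
  refine normAbs_add_le (normAbs_add_le ?_ (hg i j)) (hh i j)
  rw [Matrix.mul_apply, Fin.sum_univ_two]
  refine normAbs_add_le ?_ ?_
  · simpa using normAbs_mul_le ((hg i 0).trans hr1) (hh 0 j)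
  · simpa using normAbs_mul_le ((hg i 1).trans hr1) (hh 1 j)

variable (F) in
lemma isOpen_nearOne {r : NNReal} (hr : 0 < r) : IsOpen {g : GL (Fin 2) F | NearOne r g} := by
  have : {g : GL (Fin 2) F | NearOne r g} = ⋂ i, ⋂ j,
      (fun g : GL (Fin 2) F => g.val i j - (1 : Matrix (Fin 2) (Fin 2) F) i j) ⁻¹' (ball F r) := by
    ext g; simp [NearOne, mem_ball]
  rw [this]
  refine isOpen_iInter_of_finite fun i => isOpen_iInter_of_finite fun j => ?_
  refine (isOpen_ball hr).preimage ?_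
  exact (Units.continuous_val.matrix_elem i j).sub continuous_const

variable (F) in
/-- The principal congruence subgroup of radius `r`. -/
def congruenceSubgroup (r : NNReal) (hr0 : 0 < r) (hr : r < 1) : OpenSubgroup (GL (Fin 2) F) where
  carrier := {g | NearOne r g}
  mul_mem' := NearOne.mul hr
  one_mem' := by simp [NearOne]
  inv_mem' := NearOne.inv hr
  isOpen' := isOpen_nearOne F hr0

/-- The topology of a unit group controls the inverse as well as the matrix; `NearOne.inv` takes
care of the former. -/
lemma exists_nearOne_subset {s : Set (GL (Fin 2) F)} (hs : s ∈ 𝓝 1) :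
    ∃ r : NNReal, 0 < r ∧ r < 1 ∧ ∀ g, NearOne r g → g ∈ s := by
  rw [Units.isInducing_embedProduct.nhds_eq_comap] at hs
  obtain ⟨t, ht, hts⟩ := hs
  obtain ⟨A, hA, B, hB, hAB⟩ := mem_nhds_prod_iff.1 ht
  have hB' : MulOpposite.op ⁻¹' B ∈ 𝓝 (1 : Matrix (Fin 2) (Fin 2) F) :=
    MulOpposite.continuous_op.continuousAt.preimage_mem_nhds (by simpa using hB)
  obtain ⟨r₁, hr₁, h₁⟩ := exists_normAbs_matrix_subset (M := 1) (by simpa using hA)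
  obtain ⟨r₂, hr₂, h₂⟩ := exists_normAbs_matrix_subset hB'
  have hlt : min (min r₁ r₂) (1 / 2) < 1 := (min_le_right _ _).trans_lt (by norm_num)
  refine ⟨min (min r₁ r₂) (1 / 2), by simp [hr₁, hr₂], hlt, fun g hg => hts (hAB ⟨?_, ?_⟩)⟩
  · refine h₁ _ fun i j => (hg i j).trans ?_
    exact_mod_cast (min_le_left _ _).trans (min_le_left _ _)
  · refine h₂ (g⁻¹).val fun i j => (hg.inv hlt i j).trans ?_
    exact_mod_cast (min_le_left _ _).trans (min_le_right _ _)

end Congruence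

/-! ### The torus element diag(a, 1) and its action on unipotents. -/

section GroupIdentities

variable {F : Type*} [Field F]

@[simp] lemma diagOne_val (a : Fˣ) : (diagOne a).val = !![(a : F), 0; 0, 1] := rfl

@[simp] lemma upperRightHom_val (x : F) :
    (upperRightHom x : GL (Fin 2) F).val = !![1, x; 0, 1] := rfl

lemma diagOne_mul (a b : Fˣ) : diagOne (a * b) = diagOne a * diagOne b := by
  apply Units.ext
  simp

lemma diagOne_one : diagOne (1 : Fˣ) = 1 := by
  apply Units.ext
  simp [Matrix.one_fin_two]

lemma diagOne_inv (a : Fˣ) : (diagOne a)⁻¹ = diagOne a⁻¹ := by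
  rw [inv_eq_iff_mul_eq_one, ← diagOne_mul, mul_inv_cancel, diagOne_one]

lemma diagOne_mul_upperRightHom (a : Fˣ) (x : F) :
    diagOne a * upperRightHom x = upperRightHom ((a : F) * x) * diagOne a := by
  apply Units.ext
  simp

lemma continuous_diagOne [TopologicalSpace F] [IsTopologicalRing F] :
    Continuous (diagOne (F := F)) := by
  have h : Continuous fun a : Fˣ => (!![(a : F), 0; 0, 1] : Matrix (Fin 2) (Fin 2) F) := by
    refine continuous_matrix fun i j => ?_
    fin_cases i <;> fin_cases j <;> simp [Units.continuous_val, continuous_const]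
  refine Units.continuous_iff.2 ⟨h, ?_⟩
  have : (fun a : Fˣ => ((diagOne a)⁻¹).val) = fun a : Fˣ => (diagOne a⁻¹).val := by
    funext a; rw [diagOne_inv]
  rw [this]
  exact h.comp continuous_inv

end GroupIdentities

/-! ### Equivariance and local constancy of Whittaker functions. -/

section Whittaker

variable {F : Type*} [Field F] [TopologicalSpace F]
  {V : Type*} [AddCommGroup V] [Module ℂ V] {π : Representation ℂ (GL (Fin 2) F) V}
  {ψ : AddChar F Circle} {l : V →ₗ[ℂ] ℂ}

lemma IsWhittakerFunctional.apply_mul (hl : IsWhittakerFunctional π ψ l) (x : F)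
    (g : GL (Fin 2) F) (v : V) :
    l (π (upperRightHom x * g) v) = (ψ x : ℂ) * l (π g v) := by
  rw [map_mul]; exact hl x _

/-- Moving diag(a, 1) past n(x) scales x by a. Every use of ψ below goes back to this relation. -/
lemma IsWhittakerFunctional.apply_diagOne_mul (hl : IsWhittakerFunctional π ψ l) (a : Fˣ) (x : F)
    (g : GL (Fin 2) F) (v : V) :
    l (π (diagOne a * (upperRightHom x * g)) v) = (ψ (a * x) : ℂ) * l (π (diagOne a * g) v) := by
  rw [← mul_assoc, diagOne_mul_upperRightHom, mul_assoc, hl.apply_mul]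

lemma continuous_whittaker [IsTopologicalRing F]
    (hsm : ∀ v : V, ∃ U : OpenSubgroup (GL (Fin 2) F), v ∈ fixedVectors π U)
    (l : V →ₗ[ℂ] ℂ) (v : V) : Continuous fun g : GL (Fin 2) F => l (π g v) := by
  obtain ⟨U, hU⟩ := hsm v
  refine IsLocallyConstant.continuous ((IsLocallyConstant.iff_exists_open _).2 fun g => ?_)
  refine ⟨(fun h => g⁻¹ * h) ⁻¹' (U : Set (GL (Fin 2) F)),
    U.isOpen.preimage (continuous_const_mul _), by simp, fun h hh => ?_⟩
  have h1 : π (g⁻¹ * h) v = v := hU _ hh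
  have h2 : π h v = π g (π (g⁻¹ * h) v) := by
    rw [← Module.End.mul_apply, ← map_mul, mul_inv_cancel_left]
  simp only [h2, h1]

end Whittaker

/-! ### Vectors fixed by congruence subgroups, and an averaging operator on them. -/

section Fixed

variable {F : Type*} [Field F] [ValuativeRel F] [TopologicalSpace F]
  [IsNonarchimedeanLocalField F]
  {V : Type*} [AddCommGroup V] [Module ℂ V]

/-- `v` is fixed by the matrices that are congruent to `1` modulo the ball of radius `r`. -/
def IsFixed (π : Representation ℂ (GL (Fin 2) F) V) (r : NNReal) (v : V) : Prop :=
  ∀ g, NearOne r g → π g v = v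

variable {π : Representation ℂ (GL (Fin 2) F) V} {ψ : AddChar F Circle} {l : V →ₗ[ℂ] ℂ}

lemma IsFixed.mono {r s : NNReal} {v : V} (h : IsFixed π r v) (hs : s ≤ r) : IsFixed π s v :=
  fun g hg => h g fun i j => (hg i j).trans (by exact_mod_cast hs)

lemma exists_isFixed (hsm : ∀ v : V, ∃ U : OpenSubgroup (GL (Fin 2) F), v ∈ fixedVectors π U)
    (v : V) : ∃ r : NNReal, 0 < r ∧ r < 1 ∧ IsFixed π r v := by
  obtain ⟨U, hU⟩ := hsm v
  obtain ⟨r, h0, h1, hr⟩ := exists_nearOne_subset (U.isOpen.mem_nhds U.one_mem)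
  exact ⟨r, h0, h1, fun g hg => hU g (hr g hg)⟩

lemma nearOne_upperRightHom {r : NNReal} {x : F} (hx : normAbs x ≤ r) :
    NearOne r (upperRightHom x : GL (Fin 2) F) := by
  rw [nearOne_iff]; simp [hx]

lemma IsFixed.apply_mul {r : NNReal} {v : V} (h : IsFixed π r v) {k : GL (Fin 2) F}
    (hk : NearOne r k) (g : GL (Fin 2) F) : π (g * k) v = π g v := by
  rw [map_mul, Module.End.mul_apply, h k hk]

/-- Where the Whittaker function of a vector fixed at level `r` is non-zero, `ψ(a ·)` is trivial on
the ball of radius `r`. -/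
lemma IsFixed.whittaker_mul_eq {r : NNReal} {v : V} (h : IsFixed π r v)
    (hl : IsWhittakerFunctional π ψ l) (a : Fˣ) {x : F} (hx : normAbs x ≤ r) :
    (ψ (a * x) : ℂ) * l (π (diagOne a) v) = l (π (diagOne a) v) := by
  have h1 := hl.apply_diagOne_mul a x 1 v
  rw [mul_one, mul_one, h.apply_mul (nearOne_upperRightHom hx)] at h1
  exact h1.symm

/-- For large |a| the dilate by a of the ball of radius r contains a point y with ψ y ≠ 1, and
`IsFixed.whittaker_mul_eq` then forces the value to vanish. -/
lemma IsFixed.whittaker_eq_zero {r : NNReal} (hr : 0 < r) {v : V} (h : IsFixed π r v)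
    (hl : IsWhittakerFunctional π ψ l) (hψ1 : ψ ≠ 1) :
    ∃ C : ℝ, ∀ a : Fˣ, C < normAbs (a : F) → l (π (diagOne a) v) = 0 := by
  obtain ⟨y, hy⟩ := (AddChar.ne_one_iff).1 hψ1
  refine ⟨normAbs y / r, fun a ha => ?_⟩
  have hr' : (0 : ℝ) < r := hr
  have hx : normAbs ((a : F)⁻¹ * y) ≤ r := by
    rw [normAbs_mul, normAbs_inv, inv_mul_le_iff₀ (normAbs_unit_pos a)]
    rw [div_lt_iff₀ hr'] at ha
    exact ha.le
  have h1 := h.whittaker_mul_eq hl a hx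
  rw [mul_inv_cancel_left₀ a.ne_zero] at h1
  by_contra h0
  refine hy (Circle.coe_injective ?_)
  rw [Circle.coe_one]
  exact mul_right_cancel₀ h0 (by rw [h1, one_mul])

/-- The operator `∑ π(n(x) diag(ϖ, 1))`, summed over the cosets of the ball of radius `|ϖ| r`
in the ball of radius `r`, preserves the vectors fixed at level `r`. -/
lemma IsFixed.sum_upperRightHom {r q : NNReal} {ϖ : Fˣ} (hq : (q : ℝ) = normAbs (ϖ : F))
    (hq1 : q < 1) (hrq : r ≤ q) {X : Finset F} (hX : IsCosetReps X (ball F r) (ball F (q * r)))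
    {v : V} (h : IsFixed π r v) :
    IsFixed π r (∑ x ∈ X, π (upperRightHom x * diagOne ϖ) v) := by
  have hr1 : r < 1 := hrq.trans_lt hq1
  have hr1' : (r : ℝ) ≤ 1 := by exact_mod_cast hr1.le
  have hrq' : (r : ℝ) ≤ q := by exact_mod_cast hrq
  have hq0 : (0 : ℝ) < q := hq ▸ normAbs_unit_pos ϖ
  have hq1' : (q : ℝ) ≤ 1 := by exact_mod_cast hq1.le
  intro k hk
  obtain ⟨ha, hb, hc, hd⟩ := nearOne_iff.1 hk
  -- The summand depends only on the coset of x, since diag(ϖ, 1) contracts the ball of radius r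
  -- onto that of radius |ϖ| r.
  have hinv : ∀ x ∈ ball F r, ∀ y ∈ ball F (q * r),
      π (upperRightHom (x + y) * diagOne ϖ) v = π (upperRightHom x * diagOne ϖ) v := by
    intro x _ y hy
    have h1 : (upperRightHom (x + y) * diagOne ϖ : GL (Fin 2) F) =
        (upperRightHom x * diagOne ϖ) * upperRightHom ((ϖ : F)⁻¹ * y) := by
      rw [mul_assoc, diagOne_mul_upperRightHom, mul_inv_cancel_left₀ ϖ.ne_zero, ← mul_assoc,
        AddChar.map_add_eq_mul]
    rw [h1]
    refine h.apply_mul (nearOne_upperRightHom ?_) _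
    rw [normAbs_mul, normAbs_inv, ← hq, inv_mul_le_iff₀ hq0]
    exact_mod_cast (mem_ball.1 hy)
  rw [map_sum, ← hX.sum_add (f := fun x => π (upperRightHom x * diagOne ϖ) v) hinv
    (y := k.val 0 1) hb]
  refine Finset.sum_congr rfl fun x hx => ?_
  have hx : normAbs x ≤ r := hX.mem x hx
  -- Left multiplication by k translates x by its upper right entry, up to an error k' on the right.
  -- The corresponding entry of k' carries ϖ⁻¹; it stays small because r ≤ |ϖ| puts products of two
  -- elements of the ball of radius r into the ball of radius |ϖ| r.
  obtain ⟨k', hk'⟩ : ∃ k', k * (upperRightHom x * diagOne ϖ) =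
      (upperRightHom (x + k.val 0 1) * diagOne ϖ) * k' := ⟨_, (mul_inv_cancel_left _ _).symm⟩
  rw [← Module.End.mul_apply, ← map_mul, hk']
  refine h.apply_mul ?_ _
  have hk'' : k' = diagOne ϖ⁻¹ * (upperRightHom (-(x + k.val 0 1)) *
      (k * (upperRightHom x * diagOne ϖ))) := by
    rw [hk', ← diagOne_inv, AddChar.map_neg_eq_inv]
    group
  have hval : k'.val = !![k.val 0 0 - (x + k.val 0 1) * k.val 1 0,
      (ϖ : F)⁻¹ * (x * ((k.val 0 0 - 1) - (k.val 1 1 - 1)) - k.val 0 1 * (k.val 1 1 - 1)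
        - (x + k.val 0 1) * (k.val 1 0 * x));
      (ϖ : F) * k.val 1 0, k.val 1 0 * x + k.val 1 1] := by
    rw [hk'']
    simp only [Units.val_mul, diagOne_val, upperRightHom_val]
    rw [Matrix.eta_fin_two k.val]
    simp only [Matrix.mul_fin_two, Units.val_inv_eq_inv_val, Matrix.of_apply, Matrix.cons_val',
      Matrix.cons_val_zero, Matrix.cons_val_one, Matrix.cons_val_fin_one]
    have hϖ := ϖ.ne_zero
    ext i j
    fin_cases i <;> fin_cases j <;> simp <;> field_simp <;> ring
  have hxb : normAbs (x + k.val 0 1) ≤ r := normAbs_add_le hx hb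
  have hmul : ∀ {x y : F}, normAbs x ≤ r → normAbs y ≤ r → normAbs (x * y) ≤ q * r :=
    fun hx hy => (normAbs_mul_le hx hy).trans (mul_le_mul_of_nonneg_right hrq' r.2)
  have hmul' : ∀ {x y : F}, normAbs x ≤ r → normAbs y ≤ r → normAbs (x * y) ≤ r :=
    fun hx hy => (hmul hx hy).trans (mul_le_of_le_one_left r.2 hq1')
  rw [nearOne_iff, hval]
  refine ⟨?_, ?_, ?_, ?_⟩
  · simp only [Matrix.of_apply, Matrix.cons_val', Matrix.cons_val_zero, Matrix.cons_val_fin_one]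
    rw [sub_right_comm]
    exact normAbs_sub_le ha (hmul' hxb hc)
  · simp only [Matrix.of_apply, Matrix.cons_val', Matrix.cons_val_zero, Matrix.cons_val_one,
      Matrix.cons_val_fin_one]
    rw [normAbs_mul, normAbs_inv, ← hq, inv_mul_le_iff₀ hq0]
    exact normAbs_sub_le (normAbs_sub_le (hmul hx (normAbs_sub_le ha hd)) (hmul hb hd))
      (hmul hxb (hmul' hc hx))
  · simp only [Matrix.of_apply, Matrix.cons_val', Matrix.cons_val_zero, Matrix.cons_val_one,
      Matrix.cons_val_fin_one, normAbs_mul, ← hq]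
    exact (mul_le_of_le_one_left (normAbs_nonneg _) hq1').trans hc
  · simp only [Matrix.of_apply, Matrix.cons_val', Matrix.cons_val_one,
      Matrix.cons_val_fin_one]
    rw [add_sub_assoc]
    exact normAbs_add_le (hmul' hc hx) hd

/-- When a is so small that ψ(a ·) is trivial on the ball, all summands contribute equally: on
Whittaker functions the operator becomes the shift a ↦ aϖ, up to the number of cosets. -/
lemma IsWhittakerFunctional.apply_sum_upperRightHom (hl : IsWhittakerFunctional π ψ l) {r : NNReal}
    {L' : AddSubgroup F} {X : Finset F} (hX : IsCosetReps X (ball F r) L') {a : Fˣ}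
    (ha : ∀ x ∈ ball F r, ψ (a * x) = 1) (ϖ : Fˣ) (v : V) :
    l (π (diagOne a) (∑ x ∈ X, π (upperRightHom x * diagOne ϖ) v)) =
      X.card * l (π (diagOne (a * ϖ)) v) := by
  rw [map_sum, map_sum, Finset.sum_congr rfl (g := fun _ => l (π (diagOne (a * ϖ)) v)),
    Finset.sum_const, nsmul_eq_mul]
  intro x hx
  rw [← Module.End.mul_apply, ← map_mul, hl.apply_diagOne_mul, ha x (hX.mem x hx), diagOne_mul]
  simp

end Fixed

/-! ### Growth of Whittaker functions near zero and convergence of zeta integrals. -/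

section Growth

/-- The orbit of a vector under an endomorphism of a finite-dimensional space grows at most
geometrically, uniformly for a pointwise bounded family of functionals. -/
lemma exists_pow_apply_le {E : Type*} [AddCommGroup E] [Module ℂ E] [FiniteDimensional ℂ E]
    (T : E →ₗ[ℂ] E) {A : Type*} (φ : A → E →ₗ[ℂ] ℂ) (hφ : ∀ w, ∃ C : ℝ, ∀ a, ‖φ a w‖ ≤ C) (v : E) :
    ∃ C R : ℝ, 0 ≤ C ∧ 0 ≤ R ∧ ∀ (n : ℕ) (a : A), ‖φ a ((T ^ n) v)‖ ≤ C * R ^ n := by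
  let b := Module.finBasis ℂ E
  -- The ℓ¹ norm of the coordinates; T expands it by at most `R`, the sum of the absolute values of
  -- its matrix entries.
  let N : E → ℝ := fun w => ∑ i, ‖b.repr w i‖
  have hN0 : ∀ w, 0 ≤ N w := fun w => Finset.sum_nonneg fun i _ => norm_nonneg _
  have hb : ∀ (G : E →ₗ[ℂ] ℂ) (w : E) (D : Fin (Module.finrank ℂ E) → ℝ),
      (∀ i, ‖G (b i)‖ ≤ D i) → ‖G w‖ ≤ (∑ i, D i) * N w := by
    intro G w D hD
    conv_lhs => rw [← b.sum_repr w]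
    rw [map_sum, Finset.sum_mul]
    refine norm_sum_le_of_le _ fun i _ => ?_
    rw [map_smul, smul_eq_mul, norm_mul, mul_comm]
    exact mul_le_mul (hD i) (Finset.single_le_sum (f := fun i => ‖b.repr w i‖)
      (fun i _ => norm_nonneg _) (Finset.mem_univ i)) (norm_nonneg _) ((norm_nonneg _).trans (hD i))
  let R : ℝ := ∑ j, ∑ i, ‖b.repr (T (b i)) j‖
  have hR0 : 0 ≤ R := Finset.sum_nonneg fun _ _ => Finset.sum_nonneg fun _ _ => norm_nonneg _
  have hT : ∀ w, N (T w) ≤ R * N w := by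
    intro w
    rw [Finset.sum_mul]
    exact Finset.sum_le_sum fun j _ =>
      hb ((b.coord j).comp T) w (fun i => ‖b.repr (T (b i)) j‖) fun i => le_rfl
  have hTn : ∀ n : ℕ, N ((T ^ n) v) ≤ R ^ n * N v := by
    intro n
    induction n with
    | zero => simp
    | succ n ih =>
      rw [pow_succ', Module.End.mul_apply, pow_succ', mul_assoc]
      exact (hT _).trans (mul_le_mul_of_nonneg_left ih hR0)
  choose D hD using fun i => hφ (b i)
  -- The absolute value covers an empty family, for which the bounds `D i` may be negative.
  refine ⟨|∑ i, D i| * N v, R, mul_nonneg (abs_nonneg _) (hN0 v), hR0, fun n a => ?_⟩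
  calc ‖φ a ((T ^ n) v)‖ ≤ (∑ i, D i) * N ((T ^ n) v) := hb (φ a) _ D fun i => hD i a
    _ ≤ |∑ i, D i| * N ((T ^ n) v) := mul_le_mul_of_nonneg_right (le_abs_self _) (hN0 _)
    _ ≤ |∑ i, D i| * (R ^ n * N v) := mul_le_mul_of_nonneg_left (hTn n) (abs_nonneg _)
    _ = _ := by ring

variable {F : Type*} [Field F] [ValuativeRel F] [TopologicalSpace F]
  [IsNonarchimedeanLocalField F]

/-- Closed annuli in `Fˣ` are compact. -/
lemma isCompact_annulus {c C : ℝ} (hc : 0 < c) :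
    IsCompact {a : Fˣ | c ≤ normAbs (a : F) ∧ normAbs (a : F) ≤ C} := by
  rcases lt_or_ge C 0 with hC | hC
  · convert isCompact_empty
    ext a
    simp only [Set.mem_ofPred_eq, Set.mem_empty_iff_false, iff_false, not_and, not_le]
    exact fun _ => hC.trans_le (normAbs_nonneg _)
  lift C to NNReal using hC
  lift c to NNReal using hc.le
  -- Compactness in Fˣ means bounding both a and a⁻¹: the units are closed in the product via a ↦
  -- (a, a⁻¹).
  have h := Units.isClosedEmbedding_embedProduct (α := F).isCompact_preimage
    ((isCompact_ball (F := F) C).prod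
      ((isCompact_ball (F := F) c⁻¹).image MulOpposite.continuous_op))
  convert h using 1
  ext a
  simp only [Set.mem_ofPred_eq, Set.mem_preimage, Units.embedProduct_apply, Set.mem_prod,
    SetLike.mem_coe, mem_ball, Set.mem_image, MulOpposite.op_inj, exists_eq_right,
    Units.val_inv_eq_inv_val, normAbs_inv, NNReal.coe_inv]
  rw [inv_le_inv₀ (normAbs_unit_pos a) hc, and_comm]

/-- The absolute value is locally constant on `Fˣ`. -/
lemma continuous_normAbs_units : Continuous fun a : Fˣ => normAbs (a : F) := by
  refine IsLocallyConstant.continuous ((IsLocallyConstant.iff_eventually_eq _).2 fun a => ?_)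
  have hs : {y : F | normAbs (y - a) < normAbs (a : F)} ∈ 𝓝 (a : F) := by
    have : Filter.Tendsto (fun y : F => y - a) (𝓝 (a : F)) (𝓝 0) := by
      have := (continuous_sub_right (a : F)).tendsto (a : F)
      rwa [sub_self] at this
    have h2 : {x : F | normAbs x < normAbs (a : F)} ∈ 𝓝 (0 : F) := by
      have hp := normAbs_unit_pos a
      exact Filter.mem_of_superset
        ((hasBasis_nhds_zero_normAbs F).mem_of_mem (half_pos hp)) fun x (hx : _ ≤ _) =>
          hx.trans_lt (half_lt_self hp)
    exact this h2
  filter_upwards [Units.continuous_val.continuousAt.preimage_mem_nhds hs] with y hy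
  exact normAbs_eq_of_sub_lt hy

lemma continuous_absPow (s : ℂ) : Continuous fun a : Fˣ => absPow a s := by
  have h : Continuous fun a : Fˣ => ((normAbs (a : F) : ℝ) : ℂ) :=
    Complex.continuous_ofReal.comp continuous_normAbs_units
  refine h.cpow continuous_const fun a => ?_
  exact Complex.ofReal_mem_slitPlane.2 (normAbs_unit_pos a)

lemma norm_absPow (a : Fˣ) (s : ℂ) : ‖absPow a s‖ = normAbs (a : F) ^ s.re := by
  rw [absPow, Complex.norm_cpow_eq_rpow_re_of_pos (normAbs_unit_pos a)]

variable {V : Type*} [AddCommGroup V] [Module ℂ V]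
  {π : Representation ℂ (GL (Fin 2) F) V} {ψ : AddChar F Circle} {l : V →ₗ[ℂ] ℂ}

/-- Whittaker functions of vectors of an admissible representation grow at most polynomially
near zero. -/
lemma exists_whittaker_growth
    (hsm : ∀ v : V, ∃ U : OpenSubgroup (GL (Fin 2) F), v ∈ fixedVectors π U)
    (hadm : ∀ U : OpenSubgroup (GL (Fin 2) F), FiniteDimensional ℂ (fixedVectors π U))
    (hψ : Continuous ψ) (hl : IsWhittakerFunctional π ψ l) {ϖ : Fˣ} (hϖ : normAbs (ϖ : F) < 1)
    (v : V) :
    ∃ c C R : ℝ, 0 < c ∧ 0 ≤ C ∧ 0 ≤ R ∧ ∀ (n : ℕ) (a : Fˣ), normAbs (ϖ : F) * c ≤ normAbs (a : F) →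
      normAbs (a : F) ≤ c → ‖l (π (diagOne (a * ϖ ^ n)) v)‖ ≤ C * R ^ n := by
  obtain ⟨r', hr'0, -, hfix'⟩ := exists_isFixed hsm v
  let q : NNReal := ⟨normAbs (ϖ : F), normAbs_nonneg _⟩
  have hq : (q : ℝ) = normAbs (ϖ : F) := rfl
  have hq0 : 0 < q := normAbs_unit_pos ϖ
  have hq1 : q < 1 := hϖ
  let r : NNReal := min r' q
  have hr0 : 0 < r := lt_min hr'0 hq0
  have hrq : r ≤ q := min_le_right _ _
  have hr1 : r < 1 := hrq.trans_lt hq1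
  have hfix : IsFixed π r v := hfix'.mono (min_le_left _ _)
  obtain ⟨X, hX⟩ := exists_isCosetReps (isCompact_ball (F := F) r)
    (isOpen_ball (F := F) (mul_pos hq0 hr0))
  obtain ⟨δ, hδ, hδψ⟩ := exists_addChar_eq_one hψ
  let c : ℝ := δ / r
  have hr0' : (0 : ℝ) < r := hr0
  have hc : 0 < c := div_pos hδ hr0'
  have htriv : ∀ a : Fˣ, normAbs (a : F) ≤ c → ∀ x ∈ ball F r, ψ (a * x) = 1 := by
    intro a ha x hx
    refine hδψ _ ((normAbs_mul_le ha hx).trans_eq ?_)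
    simp only [c]; field_simp
  let E := fixedVectors π (congruenceSubgroup F r hr0 hr1)
  have : FiniteDimensional ℂ E := hadm _
  have hX0 : (X.card : ℂ) ≠ 0 := by exact_mod_cast hX.nonempty.card_pos.ne'
  -- Dividing by the number of cosets makes T exactly the shift a ↦ aϖ on |a| ≤ c.
  let T₀ : V →ₗ[ℂ] V := (X.card : ℂ)⁻¹ • ∑ x ∈ X, π (upperRightHom x * diagOne ϖ)
  have hT₀ : ∀ w ∈ E, T₀ w ∈ E := by
    intro w hw
    refine E.smul_mem _ ?_
    rw [LinearMap.sum_apply]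
    exact IsFixed.sum_upperRightHom (π := π) hq hq1 hrq hX (v := w) hw
  let T : E →ₗ[ℂ] E := T₀.restrict hT₀
  have hTW : ∀ (a : Fˣ) (w : E), normAbs (a : F) ≤ c →
      l (π (diagOne a) (T w)) = l (π (diagOne (a * ϖ)) w) := by
    intro a w ha
    have h1 := hl.apply_sum_upperRightHom hX (htriv a ha) ϖ (w : V)
    change l (π (diagOne a) (T₀ w)) = _
    simp only [T₀, LinearMap.smul_apply, LinearMap.sum_apply, map_smul, smul_eq_mul]
    rw [h1, inv_mul_cancel_left₀ hX0]
  have hTn : ∀ (n : ℕ) (a : Fˣ) (w : E), normAbs (a : F) ≤ c →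
      l (π (diagOne a) ((T ^ n) w : E)) = l (π (diagOne (a * ϖ ^ n)) w) := by
    intro n
    induction n with
    | zero => intro a w _; simp
    | succ n ih =>
      intro a w ha
      have ha' : normAbs ((a * ϖ : Fˣ) : F) ≤ c := by
        rw [Units.val_mul, normAbs_mul]
        exact (mul_le_of_le_one_right (normAbs_nonneg _) hϖ.le).trans ha
      rw [pow_succ', Module.End.mul_apply, hTW a _ ha, ih _ _ ha', mul_assoc, ← pow_succ']
  let S : Set Fˣ := {a | normAbs (ϖ : F) * c ≤ normAbs (a : F) ∧ normAbs (a : F) ≤ c}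
  have hS : IsCompact S := isCompact_annulus (mul_pos (normAbs_unit_pos ϖ) hc)
  obtain ⟨C, R, hC, hR, h⟩ := exists_pow_apply_le T
    (fun a : S => (l.comp (π (diagOne (a : Fˣ)))).comp E.subtype) (fun w => by
      obtain ⟨C, hC⟩ := hS.exists_bound_of_continuousOn
        (((continuous_whittaker hsm l (w : V)).comp continuous_diagOne).continuousOn)
      exact ⟨C, fun a => hC a a.2⟩) ⟨v, hfix⟩
  refine ⟨c, C, R, hc, hC, hR, fun n a ha1 ha2 => ?_⟩
  rw [← hTn n a ⟨v, hfix⟩ ha2]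
  exact h n ⟨a, ha1, ha2⟩

lemma continuous_zetaIntegrand
    (hsm : ∀ v : V, ∃ U : OpenSubgroup (GL (Fin 2) F), v ∈ fixedVectors π U)
    {μ : Fˣ →* ℂˣ} (hμ : Continuous μ) (v : V) (s : ℂ) :
    Continuous (zetaIntegrand (fun g => l (π g v)) μ s) :=
  (((continuous_whittaker hsm l v).comp continuous_diagOne).mul
    (Units.continuous_val.comp hμ)).mul (continuous_absPow _)

/-- The support lies in |a| ≤ B. Below c it is cut into translates of one compact shell; these have
equal measure, and the integrand is dominated on them by a geometric sequence of ratio ρ, which is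
less than 1 for large Re s. The rest is a compact annulus. -/
lemma exists_zetaConverges [MeasurableSpace F] [BorelSpace F] (dm : Measure Fˣ) [dm.IsHaarMeasure]
    (hsm : ∀ v : V, ∃ U : OpenSubgroup (GL (Fin 2) F), v ∈ fixedVectors π U)
    (hadm : ∀ U : OpenSubgroup (GL (Fin 2) F), FiniteDimensional ℂ (fixedVectors π U))
    (hψ : Continuous ψ) (hψ1 : ψ ≠ 1) (hl : IsWhittakerFunctional π ψ l)
    {μ : Fˣ →* ℂˣ} (hμ : Continuous μ) (v : V) :
    ∃ σ : ℝ, ∀ s : ℂ, σ < s.re → ZetaConverges dm (fun g => l (π g v)) μ s := by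
  obtain ⟨ϖ, hϖ, -⟩ := exists_uniformizer F
  have hϖ0 := normAbs_unit_pos ϖ
  obtain ⟨c, C, R, hc, hC, hR, hgrow⟩ := exists_whittaker_growth hsm hadm hψ hl hϖ v
  obtain ⟨r, hr0, -, hfix⟩ := exists_isFixed hsm v
  obtain ⟨B, hB⟩ := hfix.whittaker_eq_zero hr0 hl hψ1
  let Q : ℝ := R * ‖(μ ϖ : ℂ)‖
  have hQ : 0 ≤ Q := mul_nonneg hR (norm_nonneg _)
  obtain ⟨N, hN⟩ : ∃ N : ℕ, Q * normAbs (ϖ : F) ^ N < 1 := by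
    obtain ⟨N, hN⟩ := exists_pow_lt_of_lt_one (inv_pos.2 (show 0 < Q + 1 by linarith)) hϖ
    refine ⟨N, ?_⟩
    have h1 : Q * normAbs (ϖ : F) ^ N ≤ Q * (Q + 1)⁻¹ := mul_le_mul_of_nonneg_left hN.le hQ
    refine h1.trans_lt ?_
    rw [mul_inv_lt_iff₀ (by linarith)]
    linarith
  -- N was chosen with Q |ϖ|^N < 1, and the exponent in the integrand is s - 1/2.
  refine ⟨N + 1 / 2, fun s hs => ?_⟩
  let G := zetaIntegrand (fun g => l (π g v)) μ s
  have hG : Continuous G := continuous_zetaIntegrand hsm hμ v s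
  let S : ℕ → Set Fˣ := fun n =>
    {a | normAbs (ϖ : F) * c ≤ normAbs ((a * (ϖ ^ n)⁻¹ : Fˣ) : F) ∧
      normAbs ((a * (ϖ ^ n)⁻¹ : Fˣ) : F) ≤ c}
  let S₀ : Set Fˣ := {a | normAbs (ϖ : F) * c ≤ normAbs (a : F) ∧ normAbs (a : F) ≤ c}
  have hS₀ : IsCompact S₀ := isCompact_annulus (mul_pos hϖ0 hc)
  have hSpre : ∀ n, S n = (fun a => a * (ϖ ^ n)⁻¹) ⁻¹' S₀ := fun n => rfl
  have hScomp : ∀ n, IsCompact (S n) := fun n =>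
    (Homeomorph.mulRight ((ϖ ^ n)⁻¹ : Fˣ)).isCompact_preimage.2 hS₀
  have hSmeas : ∀ n, dm (S n) = dm S₀ := by
    intro n
    rw [hSpre]
    exact measure_preimage_mul_right dm ((ϖ ^ n)⁻¹) S₀
  obtain ⟨D, hD⟩ := hS₀.exists_bound_of_continuousOn
    (((Units.continuous_val.comp hμ).mul (continuous_absPow (F := F) (s - 1 / 2))).continuousOn)
  let ρ : ℝ := Q * normAbs (ϖ : F) ^ (s.re - 1 / 2)
  have hρ0 : 0 ≤ ρ := mul_nonneg hQ (Real.rpow_nonneg hϖ0.le _)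
  have hρ1 : ρ < 1 := by
    refine lt_of_le_of_lt (mul_le_mul_of_nonneg_left ?_ hQ) hN
    rw [← Real.rpow_natCast]
    exact Real.rpow_le_rpow_of_exponent_ge hϖ0 hϖ.le (by linarith)
  have habs : ∀ (a : Fˣ) (n : ℕ), ‖absPow (a * ϖ ^ n) (s - 1 / 2)‖ =
      ‖absPow a (s - 1 / 2)‖ * (normAbs (ϖ : F) ^ (s.re - 1 / 2)) ^ n := by
    intro a n
    rw [norm_absPow, norm_absPow, Units.val_mul, normAbs_mul, Units.val_pow_eq_pow_val, normAbs_pow,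
      Real.mul_rpow (normAbs_nonneg _) (pow_nonneg hϖ0.le _), ← Real.rpow_natCast,
      ← Real.rpow_mul hϖ0.le, mul_comm (n : ℝ), Real.rpow_mul hϖ0.le, Real.rpow_natCast]
    simp
  have hbound : ∀ n, ∀ a ∈ S n, ‖G a‖ ≤ C * |D| * ρ ^ n := by
    intro n a ha
    obtain ⟨b, rfl⟩ : ∃ b : Fˣ, a = b * ϖ ^ n := ⟨a * (ϖ ^ n)⁻¹, by group⟩
    have hb : b ∈ S₀ := by
      have := ha
      rw [hSpre] at this
      simpa using this
    have h1 := hgrow n b hb.1 hb.2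
    have h2 : ‖(μ b : ℂ)‖ * ‖absPow b (s - 1 / 2)‖ ≤ |D| := by
      rw [← norm_mul]
      exact (hD b hb).trans (le_abs_self D)
    simp only [G, zetaIntegrand, norm_mul, habs, map_mul, Units.val_mul, map_pow,
      Units.val_pow_eq_pow_val, norm_pow]
    calc _ = ‖l (π (diagOne (b * ϖ ^ n)) v)‖ * (‖(μ b : ℂ)‖ * ‖absPow b (s - 1 / 2)‖) *
          (‖(μ ϖ : ℂ)‖ ^ n * (normAbs (ϖ : F) ^ (s.re - 1 / 2)) ^ n) := by ring
      _ ≤ (C * R ^ n) * |D| * (‖(μ ϖ : ℂ)‖ ^ n * (normAbs (ϖ : F) ^ (s.re - 1 / 2)) ^ n) := by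
          gcongr
      _ = _ := by simp only [ρ, Q, mul_pow]; ring
  have hint : IntegrableOn G (⋃ n, S n) dm := by
    refine integrableOn_iUnion_of_summable_integral_norm
      (fun n => hG.continuousOn.integrableOn_compact (hScomp n)) ?_
    refine Summable.of_nonneg_of_le (fun n => integral_nonneg fun _ => norm_nonneg _)
      (f := fun n => C * |D| * dm.real S₀ * ρ ^ n) (fun n => ?_)
      ((summable_geometric_of_lt_one hρ0 hρ1).mul_left _)
    have h1 := norm_setIntegral_le_of_norm_le_const (μ := dm) (s := S n) (f := fun a => ‖G a‖)
      (C := C * |D| * ρ ^ n) ((hScomp n).measure_lt_top) (fun a ha => by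
        rw [norm_norm]; exact hbound n a ha)
    rw [Real.norm_of_nonneg (integral_nonneg fun _ => norm_nonneg _), measureReal_def, hSmeas n,
      ← measureReal_def] at h1
    exact h1.trans_eq (by ring)
  have hint2 : IntegrableOn G {a | c ≤ normAbs (a : F) ∧ normAbs (a : F) ≤ B} dm :=
    hG.continuousOn.integrableOn_compact (isCompact_annulus hc)
  have hint3 := hint.union hint2
  refine (integrableOn_iff_integrable_of_support_subset fun a ha => ?_).1 hint3
  have haB : normAbs (a : F) ≤ B := by
    by_contra! h
    refine ha ?_
    simp [zetaIntegrand, hB a h]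
  rcases le_total c (normAbs (a : F)) with h | h
  · exact Or.inr ⟨h, haB⟩
  · left
    obtain ⟨n, hn1, hn2⟩ := exists_nat_pow_near_of_lt_one
      (div_pos (normAbs_unit_pos a) hc) ((div_le_one hc).2 h) hϖ0 hϖ
    refine Set.mem_iUnion.2 ⟨n, ?_⟩
    have hp : 0 < normAbs (ϖ : F) ^ n := pow_pos hϖ0 n
    simp only [S, Set.mem_ofPred_eq, Units.val_mul, Units.val_inv_eq_inv_val, normAbs_mul,
      normAbs_inv, Units.val_pow_eq_pow_val, normAbs_pow]
    rw [← div_eq_mul_inv, div_le_iff₀ hp, le_div_iff₀ hp]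
    rw [div_le_iff₀ hc] at hn2
    rw [lt_div_iff₀ hc, pow_succ] at hn1
    constructor <;> nlinarith

end Growth

/-! ### Which parameters send the orbit point close to the base point. -/

section Orbit

variable {F : Type*} [Field F] [ValuativeRel F] [TopologicalSpace F]
  [IsNonarchimedeanLocalField F]

lemma normAbs_inclK_le_one (k : maxCompact F) (i j : Fin 2) : normAbs ((inclK k).val i j) ≤ 1 :=
  normAbs_integer (k.val i j)

/-- The determinants of k and k⁻¹ are both integral and multiply to 1. -/
lemma normAbs_det_inclK (k : maxCompact F) : normAbs (inclK k).val.det = 1 := by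
  have h : ∀ k : maxCompact F, normAbs (inclK k).val.det ≤ 1 := fun k => by
    rw [Matrix.det_fin_two]
    have h := normAbs_inclK_le_one k
    refine normAbs_sub_le ?_ ?_ <;> rw [← one_mul (1 : ℝ)] <;> exact normAbs_mul_le (h _ _) (h _ _)
  have h1 : (inclK k).val.det * (inclK k⁻¹).val.det = 1 := by
    rw [← Matrix.det_mul, ← Units.val_mul, ← map_mul, mul_inv_cancel, map_one, Units.val_one,
      Matrix.det_one]
  have h2 : normAbs (inclK k).val.det * normAbs (inclK k⁻¹).val.det = 1 := by
    rw [← normAbs_mul, h1, normAbs_one]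
  nlinarith [h k, h k⁻¹, normAbs_nonneg (inclK k).val.det, normAbs_nonneg (inclK k⁻¹).val.det]

/-- The pairs of matrices congruent to the base point modulo the ball of radius `r`. -/
def nearBase (r : NNReal) : Set (Matrix (Fin 2) (Fin 2) F × Matrix (Fin 2) (Fin 2) F) :=
  {p | (∀ i j, normAbs (p.1 i j - (basePoint F).1 i j) ≤ r) ∧
    ∀ i j, normAbs (p.2 i j - (basePoint F).2 i j) ≤ r}

/-- A matrix `[a, b; c, d]` of `K` for which the rows `(c, d)` and `(1, u) [a, b; c, d]` are close to
the lines spanned by `(0, 1)` and `(1, 0)` is close to an upper triangular matrix. -/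
lemma near_triangular {r : NNReal} (hr : r < 1) {a b c d u : F} (ha : normAbs a ≤ 1)
    (hb : normAbs b ≤ 1) (hc : normAbs c ≤ 1) (hd : normAbs d ≤ 1)
    (hdet : normAbs (a * d - b * c) = 1) (h1 : normAbs c ≤ r * normAbs d)
    (h2 : normAbs (b + u * d) ≤ r * normAbs (a + u * c)) :
    normAbs c ≤ r ∧ normAbs d = 1 ∧ normAbs a = 1 ∧ normAbs u ≤ 1 ∧ normAbs (b + u * d) ≤ r := by
  have hr' : (r : ℝ) < 1 := by exact_mod_cast hr
  have hr0 : (0 : ℝ) ≤ r := r.2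
  have hcr : normAbs c ≤ r := h1.trans (mul_le_of_le_one_right hr0 hd)
  have had : normAbs (a * d) = 1 := by
    rw [← hdet]
    refine normAbs_eq_of_sub_lt ?_
    rw [hdet, show a * d - (a * d - b * c) = b * c by ring, normAbs_mul]
    nlinarith [normAbs_nonneg b, normAbs_nonneg c]
  rw [normAbs_mul] at had
  have hd1 : normAbs d = 1 := by nlinarith [normAbs_nonneg a, normAbs_nonneg d]
  have ha1 : normAbs a = 1 := by rw [hd1, mul_one] at had; exact had
  have hu : normAbs u ≤ 1 := by
    -- If |u| > 1, then |b + ud| = |u| while |a + uc| ≤ |u|, so `h2` would give |u| ≤ r |u|.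
    by_contra! hu
    have h3 : normAbs (b + u * d) = normAbs u := by
      have : normAbs (u * d) = normAbs u := by rw [normAbs_mul, hd1, mul_one]
      rw [← this]
      refine normAbs_eq_of_sub_lt ?_
      rw [add_sub_cancel_right, this]
      linarith
    have h4 : normAbs (a + u * c) ≤ normAbs u := by
      refine normAbs_add_le (by linarith) ?_
      rw [normAbs_mul]
      exact mul_le_of_le_one_right (normAbs_nonneg _) hc
    rw [h3] at h2
    nlinarith [normAbs_nonneg (a + u * c)]
  refine ⟨hcr, hd1, ha1, hu, h2.trans (mul_le_of_le_one_right hr0 (normAbs_add_le ha ?_))⟩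
  rw [normAbs_mul]
  nlinarith [normAbs_nonneg u, normAbs_nonneg c]

/-- The two components of an orbit point, entry by entry. -/
lemma orbitPoint_eq (u v : F) (e : Fˣ) (k₁ k₂ : maxCompact F) :
    orbitPoint u v e k₁ k₂ =
      (!![(inclK k₁).val 1 1 * ((inclK k₂).val 0 0 + v * (inclK k₂).val 1 0) /
            ((inclK k₁).val.det * e),
          (inclK k₁).val 1 1 * ((inclK k₂).val 0 1 + v * (inclK k₂).val 1 1) /
            ((inclK k₁).val.det * e);
          -((inclK k₁).val 1 0 * ((inclK k₂).val 0 0 + v * (inclK k₂).val 1 0) /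
            ((inclK k₁).val.det * e)),
          -((inclK k₁).val 1 0 * ((inclK k₂).val 0 1 + v * (inclK k₂).val 1 1) /
            ((inclK k₁).val.det * e))],
       !![-(((inclK k₁).val 0 1 + u * (inclK k₁).val 1 1) * (inclK k₂).val 1 0 * e /
            (inclK k₁).val.det),
          -(((inclK k₁).val 0 1 + u * (inclK k₁).val 1 1) * (inclK k₂).val 1 1 * e /
            (inclK k₁).val.det);
          ((inclK k₁).val 0 0 + u * (inclK k₁).val 1 0) * (inclK k₂).val 1 0 * e /
            (inclK k₁).val.det,
          ((inclK k₁).val 0 0 + u * (inclK k₁).val 1 0) * (inclK k₂).val 1 1 * e /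
            (inclK k₁).val.det]) := by
  have hinv : ((inclK k₁)⁻¹).val = (inclK k₁).val.det⁻¹ •
      !![(inclK k₁).val 1 1, -(inclK k₁).val 0 1; -(inclK k₁).val 1 0, (inclK k₁).val 0 0] := by
    rw [Matrix.coe_units_inv, Matrix.inv_def, Matrix.adjugate_fin_two, Ring.inverse_eq_inv']
  rw [orbitPoint, hinv]
  generalize (inclK k₁).val.det = δ
  generalize (inclK k₁).val = g₁
  generalize (inclK k₂).val = g₂
  ext i j <;> fin_cases i <;> fin_cases j <;>
    simp [Matrix.mul_apply, Fin.sum_univ_two, div_eq_mul_inv] <;> ring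

/-- The constraints on the parameters of an orbit point close to the base point. -/
lemma orbitPoint_mem_nearBase {r : NNReal} (hr : r < 1) {u v : F} {e : Fˣ} {k₁ k₂ : maxCompact F}
    (h : orbitPoint u v e k₁ k₂ ∈ nearBase r) :
    (normAbs ((inclK k₁).val 1 0) ≤ r ∧ normAbs ((inclK k₁).val 1 1) = 1 ∧ normAbs u ≤ 1 ∧
      normAbs ((inclK k₁).val 0 1 + u * (inclK k₁).val 1 1) ≤ r) ∧
    (normAbs ((inclK k₂).val 1 0) ≤ r ∧ normAbs ((inclK k₂).val 1 1) = 1 ∧ normAbs v ≤ 1 ∧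
      normAbs ((inclK k₂).val 0 1 + v * (inclK k₂).val 1 1) ≤ r) ∧
    normAbs (e : F) = 1 ∧
    normAbs ((e : F) * (inclK k₂).val 1 1 / (inclK k₁).val 1 1 - 1) ≤ r ∧
    normAbs ((inclK k₁).val.det / (inclK k₂).val.det - 1) ≤ r := by
  have hr' : (r : ℝ) < 1 := by exact_mod_cast hr
  have hr0 : (0 : ℝ) ≤ r := r.2
  have hdet₁ := normAbs_det_inclK k₁
  have hdet₂ := normAbs_det_inclK k₂
  have hint₁ := normAbs_inclK_le_one k₁
  have hint₂ := normAbs_inclK_le_one k₂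
  have hδ0 : (inclK k₁).val.det ≠ 0 := fun h0 => by rw [h0] at hdet₁; simp at hdet₁
  have hδ0' : (inclK k₂).val.det ≠ 0 := fun h0 => by rw [h0] at hdet₂; simp at hdet₂
  have he0 := e.ne_zero
  -- the determinant of the sum of the two matrices
  have hsum : normAbs ((inclK k₂).val.det / (inclK k₁).val.det - 1) ≤ r := by
    have h1 : ((orbitPoint u v e k₁ k₂).1 + (orbitPoint u v e k₁ k₂).2).det =
        (inclK k₂).val.det / (inclK k₁).val.det := by
      simp only [orbitPoint]
      rw [← add_mul, ← mul_add, Matrix.det_mul, Matrix.det_mul, Matrix.coe_units_inv,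
        Matrix.det_nonsing_inv, Ring.inverse_eq_inv']
      have : (!![(e : F)⁻¹, (e : F)⁻¹ * v; 0, 0] + !![0, -(u * e); 0, (e : F)]).det = 1 := by
        rw [Matrix.det_fin_two]; simp
      rw [this]; field_simp
    rw [← h1]
    refine normAbs_det_sub_one_le hr fun i j => ?_
    have : (1 : Matrix (Fin 2) (Fin 2) F) i j = (basePoint F).1 i j + (basePoint F).2 i j := by
      fin_cases i <;> fin_cases j <;> simp [basePoint]
    rw [this, Matrix.add_apply, add_sub_add_comm]
    exact normAbs_add_le (h.1 i j) (h.2 i j)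
  have hδ : normAbs ((inclK k₁).val.det / (inclK k₂).val.det - 1) ≤ r := by
    rw [show (inclK k₁).val.det / (inclK k₂).val.det - 1 = -((inclK k₁).val.det /
      (inclK k₂).val.det * ((inclK k₂).val.det / (inclK k₁).val.det - 1)) by field_simp; ring,
      normAbs_neg, normAbs_mul, normAbs_div, hdet₁, hdet₂]
    simpa using hsum
  rw [orbitPoint_eq] at h
  obtain ⟨hA, hB⟩ := h
  have hA00 := hA 0 0
  have hA01 := hA 0 1
  have hA10 := hA 1 0
  have hB01 := hB 0 1
  have hB10 := hB 1 0
  have hB11 := hB 1 1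
  clear hA hB
  simp only [basePoint, Matrix.of_apply, Matrix.cons_val', Matrix.cons_val_zero,
    Matrix.cons_val_one, Matrix.cons_val_fin_one, sub_zero, normAbs_neg]
    at hA00 hA01 hA10 hB01 hB10 hB11
  have hA00' := normAbs_eq_one_of_sub_one_le hr hA00
  have hB11' := normAbs_eq_one_of_sub_one_le hr hB11
  rw [normAbs_div, normAbs_mul, normAbs_mul, hdet₁, one_mul] at hA00' hA01 hA10
  rw [normAbs_div, normAbs_mul, normAbs_mul, hdet₁, div_one] at hB11' hB01 hB10
  have hdet₁' := hdet₁
  have hdet₂' := hdet₂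
  rw [Matrix.det_fin_two] at hdet₁' hdet₂'
  have hE := normAbs_unit_pos e
  rw [div_le_iff₀ hE] at hA01 hA10
  rw [div_eq_one_iff_eq hE.ne'] at hA00'
  have hδdef : (inclK k₁).val.det = (inclK k₁).val 0 0 * (inclK k₁).val 1 1 -
    (inclK k₁).val 0 1 * (inclK k₁).val 1 0 := Matrix.det_fin_two _
  have hP : 0 < normAbs ((inclK k₂).val 0 0 + v * (inclK k₂).val 1 0) :=
    (normAbs_nonneg _).lt_of_ne fun h0 => by rw [← h0, mul_zero] at hA00'; exact hE.ne hA00'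
  have hD : 0 < normAbs ((inclK k₁).val 1 1) :=
    (normAbs_nonneg _).lt_of_ne fun h0 => by rw [← h0, zero_mul] at hA00'; exact hE.ne hA00'
  have hP' : 0 < normAbs ((inclK k₁).val 0 0 + u * (inclK k₁).val 1 0) :=
    (normAbs_nonneg _).lt_of_ne fun h0 => by
      rw [← h0, zero_mul, zero_mul] at hB11'; exact zero_ne_one hB11'
  have hD' : 0 < normAbs ((inclK k₂).val 1 1) :=
    (normAbs_nonneg _).lt_of_ne fun h0 => by
      rw [← h0, mul_zero, zero_mul] at hB11'; exact zero_ne_one hB11'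
  -- Both components of the orbit point have rank one: column (d₁, -c₁) times row (a₂ + vc₂, b₂ +
  -- vd₂), and column (-(b₁ + ud₁), a₁ + uc₁) times row (c₂, d₂), up to scalars. Comparing the small
  -- entries with the entry near 1 gives the ratios required by `near_triangular`.
  obtain ⟨hc₁, hd₁, ha₁, hu, hq₁⟩ := near_triangular hr (hint₁ 0 0) (hint₁ 0 1) (hint₁ 1 0)
    (hint₁ 1 1) hdet₁' (u := u) (le_of_mul_le_mul_right (by rw [mul_assoc, hA00']; exact hA10) hP)
    (le_of_mul_le_mul_right (by linear_combination hB01 - (r : ℝ) * hB11') (mul_pos hD' hE))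
  obtain ⟨hc₂, hd₂, ha₂, hv, hq₂⟩ := near_triangular hr (hint₂ 0 0) (hint₂ 0 1) (hint₂ 1 0)
    (hint₂ 1 1) hdet₂' (u := v)
    (le_of_mul_le_mul_left (by linear_combination hB10 - (r : ℝ) * hB11') (mul_pos hP' hE))
    (le_of_mul_le_mul_left (by linear_combination hA01 - (r : ℝ) * hA00') hD)
  have hp : normAbs ((inclK k₁).val 0 0 + u * (inclK k₁).val 1 0) = 1 := by
    rw [← ha₁]
    refine normAbs_eq_of_sub_lt ?_
    rw [add_sub_cancel_left, ha₁]
    refine lt_of_le_of_lt ?_ hr'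
    simpa using normAbs_mul_le hu hc₁
  have he : normAbs (e : F) = 1 := by
    rw [hp, hd₂, one_mul, one_mul] at hB11'
    exact hB11'
  refine ⟨⟨hc₁, hd₁, hu, hq₁⟩, ⟨hc₂, hd₂, hv, hq₂⟩, he, ?_, hδ⟩
  have hd₁0 : (inclK k₁).val 1 1 ≠ 0 := fun h0 => by rw [h0] at hd₁; simp at hd₁
  -- The identity det k₁ = (a₁ + uc₁)d₁ - c₁(b₁ + ud₁) shows that εd₂/d₁ differs from the lower
  -- right entry of the second component only by a multiple of c₁(b₁ + ud₁).
  have key : (e : F) * (inclK k₂).val 1 1 / (inclK k₁).val 1 1 - 1 =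
      (((inclK k₁).val 0 0 + u * (inclK k₁).val 1 0) * (inclK k₂).val 1 1 * e /
        (inclK k₁).val.det - 1) -
      (e * (inclK k₂).val 1 1 / ((inclK k₁).val.det * (inclK k₁).val 1 1)) *
        ((inclK k₁).val 1 0 * ((inclK k₁).val 0 1 + u * (inclK k₁).val 1 1)) := by
    field_simp
    rw [hδdef]
    ring
  rw [key]
  refine normAbs_sub_le hB11 ?_
  rw [normAbs_mul, normAbs_div, normAbs_mul, normAbs_mul, he, hd₂, hdet₁, hd₁, mul_one, div_one,
    one_mul]
  simpa using normAbs_mul_le (hint₁ 1 0) hq₁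

end Orbit

/-! ### The inner integrand as a translate of the zeta integrand. -/

section Inner

variable {F : Type*} [Field F] [ValuativeRel F] [TopologicalSpace F]
  [IsNonarchimedeanLocalField F] {V : Type*} [AddCommGroup V] [Module ℂ V]
  {π : Representation ℂ (GL (Fin 2) F) V} {ψ : AddChar F Circle} {l : V →ₗ[ℂ] ℂ}

lemma absPow_mul (a b : Fˣ) (s : ℂ) : absPow (a * b) s = absPow a s * absPow b s := by
  rw [absPow, Units.val_mul, normAbs_mul, Complex.ofReal_mul,
    Complex.mul_cpow_ofReal_nonneg (normAbs_nonneg _) (normAbs_nonneg _)]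
  rfl

lemma absPow_eq_one {a : Fˣ} (ha : normAbs (a : F) = 1) (s : ℂ) : absPow a s = 1 := by
  rw [absPow, ha, Complex.ofReal_one, Complex.one_cpow]

/-- For `k = [a, b; c, d]` in `K` close to an upper triangular matrix and `u` close to `-b / d`, the
integrand of the inner integral is a translate of the integrand of the zeta integral. -/
lemma innerIntegrand_eq {r : NNReal} {v : V} (hv : IsFixed π r v)
    (hl : IsWhittakerFunctional π ψ l) {ω : Fˣ →* ℂˣ} (hω : IsCentralCharacter π ω)
    (χ : Fˣ →* ℂˣ) {u : F} {k : maxCompact F} {d t : Fˣ} (hd : (d : F) = (inclK k).val 1 1)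
    (ht : (t : F) = (inclK k).val.det / (inclK k).val 1 1 ^ 2)
    (hc1 : normAbs ((inclK k).val 1 0) ≤ r) (hd1 : normAbs ((inclK k).val 1 1) = 1)
    (hq : normAbs ((inclK k).val 0 1 + u * (inclK k).val 1 1) ≤ r) (s : ℂ) (α : Fˣ) :
    innerIntegrand ψ (fun g => l (π g v)) χ s u k α =
      ((ω d : ℂ) * ((χ t)⁻¹ : ℂˣ)) * zetaIntegrand (fun g => l (π g v)) χ s (α * t) := by
  have hdet := normAbs_det_inclK k
  have ht1 : normAbs (t : F) = 1 := by rw [ht, normAbs_div, normAbs_pow, hd1, hdet]; simp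
  have hd0 : (inclK k).val 1 1 ≠ 0 := hd ▸ d.ne_zero
  -- The factorization into unipotent, scalar, torus and lower unipotent parts; the last one lies in
  -- the congruence subgroup because |c/d| ≤ r.
  obtain ⟨k', hk'⟩ : ∃ k', inclK k = upperRightHom ((inclK k).val 0 1 / (inclK k).val 1 1) *
      (Matrix.GeneralLinearGroup.scalar (Fin 2) d * diagOne t) * k' :=
    ⟨_, (mul_inv_cancel_left _ _).symm⟩
  have hk'val : k'.val = !![1, 0; (inclK k).val 1 0 / (inclK k).val 1 1, 1] := by
    have h1 : (upperRightHom ((inclK k).val 0 1 / (inclK k).val 1 1) *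
        (Matrix.GeneralLinearGroup.scalar (Fin 2) d * diagOne t)).val *
          !![1, 0; (inclK k).val 1 0 / (inclK k).val 1 1, 1] = (inclK k).val := by
      have hs : (Matrix.GeneralLinearGroup.scalar (Fin 2) d).val = !![(d : F), 0; 0, (d : F)] := by
        ext i j
        fin_cases i <;> fin_cases j <;> simp
      simp only [Units.val_mul, upperRightHom_val, diagOne_val, hs, ht, Matrix.det_fin_two, hd,
        Matrix.mul_fin_two]
      rw [Matrix.eta_fin_two (inclK k).val]
      ext i j
      fin_cases i <;> fin_cases j <;> simp <;> field_simp <;> ring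
    have h2 := congrArg Units.val hk'
    rw [Units.val_mul] at h2
    exact ((Units.mul_right_inj _).1 (h1.trans h2)).symm
  have hk'1 : NearOne r k' := by
    rw [nearOne_iff, hk'val]
    simpa [hd1] using hc1
  have hW : l (π (diagOne α * inclK k) v) =
      ψ (α * ((inclK k).val 0 1 / (inclK k).val 1 1)) * ((ω d : ℂ) * l (π (diagOne (α * t)) v)) := by
    conv_lhs => rw [hk']
    rw [← mul_assoc, hv.apply_mul hk'1, hl.apply_diagOne_mul, ← mul_assoc (diagOne α),
      ← Matrix.GeneralLinearGroup.scalar_commute, mul_assoc, ← diagOne_mul, map_mul π,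
      Module.End.mul_apply, hω, map_smul, smul_eq_mul]
  have hz : normAbs (((inclK k).val 0 1 / (inclK k).val 1 1 + u) / t) ≤ r := by
    rw [normAbs_div, ht1, div_one, show (inclK k).val 0 1 / (inclK k).val 1 1 + u =
      ((inclK k).val 0 1 + u * (inclK k).val 1 1) / (inclK k).val 1 1 by field_simp,
      normAbs_div, hd1, div_one]
    exact hq
  -- Applied at αt to (u + b/d)/t: the leftover phase ψ(α(u + b/d)) is invisible to the Whittaker
  -- function.
  have hψ := hv.whittaker_mul_eq hl (α * t) hz
  rw [Units.val_mul, mul_assoc, mul_div_cancel₀ _ t.ne_zero, mul_add, AddChar.map_add_eq_mul,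
    Circle.coe_mul] at hψ
  rw [innerIntegrand, zetaIntegrand, hW, absPow_mul, absPow_eq_one ht1, map_mul χ, Units.val_mul,
    mul_comm u, Units.val_inv_eq_inv_val]
  have hχ : (χ t : ℂ)⁻¹ * χ t = 1 := inv_mul_cancel₀ (χ t).ne_zero
  linear_combination ((ω d : ℂ) * χ α * absPow α (s - 1 / 2)) * hψ -
    ((ω d : ℂ) * χ α * absPow α (s - 1 / 2) * l (π (diagOne (α * t)) v)) * hχ

/-- The central character of a nonzero smooth representation is trivial near one. -/
lemma IsFixed.centralCharacter_eq_one {r : NNReal} {v : V} (hv : IsFixed π r v) (hv0 : v ≠ 0)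
    {ω : Fˣ →* ℂˣ} (hω : IsCentralCharacter π ω) {z : Fˣ} (hz : normAbs ((z : F) - 1) ≤ r) :
    ω z = 1 := by
  have h1 : NearOne r (Matrix.GeneralLinearGroup.scalar (Fin 2) z) := by
    rw [nearOne_iff]
    simp [hz]
  have h2 := hω z v
  rw [hv _ h1] at h2
  apply Units.ext
  rw [Units.val_one]
  by_contra h3
  refine hv0 ((smul_eq_zero.1 (?_ : ((ω z : ℂ) - 1) • v = 0)).resolve_left (sub_ne_zero.2 h3))
  rw [sub_smul, one_smul, ← h2, sub_self]

end Inner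

/-! ### Compact open neighbourhoods of the base point and their indicators. -/

section NearBase

variable {F : Type*} [Field F] [ValuativeRel F] [TopologicalSpace F]
  [IsNonarchimedeanLocalField F]

lemma isOpen_isCompact_matrix_ball (M : Matrix (Fin 2) (Fin 2) F) {r : NNReal} (hr : 0 < r) :
    IsOpen {N : Matrix (Fin 2) (Fin 2) F | ∀ i j, normAbs (N i j - M i j) ≤ r} ∧
    IsCompact {N : Matrix (Fin 2) (Fin 2) F | ∀ i j, normAbs (N i j - M i j) ≤ r} := by
  have h : {N : Matrix (Fin 2) (Fin 2) F | ∀ i j, normAbs (N i j - M i j) ≤ r} =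
      Set.univ.pi fun i => Set.univ.pi fun j => (Homeomorph.subRight (M i j)) ⁻¹' (ball F r) := by
    ext N
    exact ⟨fun h i _ j _ => h i j, fun h i j => h i trivial j trivial⟩
  rw [h]
  exact ⟨isOpen_set_pi Set.finite_univ fun i _ => isOpen_set_pi Set.finite_univ fun j _ =>
      (isOpen_ball hr).preimage (Homeomorph.continuous _),
    isCompact_univ_pi fun i => isCompact_univ_pi fun j =>
      (Homeomorph.isCompact_preimage _).2 (isCompact_ball r)⟩

lemma isOpen_nearBase {r : NNReal} (hr : 0 < r) : IsOpen (nearBase (F := F) r) :=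
  (isOpen_isCompact_matrix_ball (basePoint F).1 hr).1.prod
    (isOpen_isCompact_matrix_ball (basePoint F).2 hr).1

lemma isCompact_nearBase {r : NNReal} (hr : 0 < r) : IsCompact (nearBase (F := F) r) :=
  (isOpen_isCompact_matrix_ball (basePoint F).1 hr).2.prod
    (isOpen_isCompact_matrix_ball (basePoint F).2 hr).2

lemma isClosed_nearBase {r : NNReal} (hr : 0 < r) : IsClosed (nearBase (F := F) r) :=
  (isCompact_nearBase hr).isClosed

lemma nearBase_mono {r s : NNReal} (h : r ≤ s) : nearBase (F := F) r ⊆ nearBase s :=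
  fun _ hp => ⟨fun i j => (hp.1 i j).trans (by exact_mod_cast h),
    fun i j => (hp.2 i j).trans (by exact_mod_cast h)⟩

lemma exists_nearBase_subset {U : Set (Matrix (Fin 2) (Fin 2) F × Matrix (Fin 2) (Fin 2) F)}
    (hU : U ∈ 𝓝 (basePoint F)) : ∃ r : NNReal, 0 < r ∧ nearBase r ⊆ U := by
  obtain ⟨A, hA, B, hB, hAB⟩ := mem_nhds_prod_iff.1 hU
  obtain ⟨r₁, hr₁, h₁⟩ := exists_normAbs_matrix_subset hA
  obtain ⟨r₂, hr₂, h₂⟩ := exists_normAbs_matrix_subset hB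
  refine ⟨min r₁ r₂, lt_min hr₁ hr₂, fun p hp => hAB ⟨h₁ _ fun i j => ?_, h₂ _ fun i j => ?_⟩⟩
  · exact (nearBase_mono (min_le_left _ _) hp).1 i j
  · exact (nearBase_mono (min_le_right _ _) hp).2 i j

lemma isLocallyConstant_indicator {X : Type*} [TopologicalSpace X] {S : Set X} (ho : IsOpen S)
    (hc : IsClosed S) (c : ℂ) : IsLocallyConstant (S.indicator fun _ => c) := by
  refine (IsLocallyConstant.iff_exists_open _).2 fun x => ?_
  by_cases hx : x ∈ S
  · exact ⟨S, ho, hx, fun y hy => by simp [hx, hy]⟩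
  · exact ⟨Sᶜ, hc.isOpen_compl, hx, fun y hy => by
      rw [Set.indicator_of_notMem hx, Set.indicator_of_notMem hy]⟩

lemma tsupport_indicator_subset {X : Type*} [TopologicalSpace X] {S : Set X}
    (hc : IsClosed S) (c : ℂ) : tsupport (S.indicator fun _ => c) ⊆ S :=
  closure_minimal Set.support_indicator_subset hc

lemma isSchwartzBruhat_indicator_nearBase {r : NNReal} (hr : 0 < r) (c : ℂ) :
    IsSchwartzBruhat ((nearBase (F := F) r).indicator fun _ => c) :=
  ⟨isLocallyConstant_indicator (isOpen_nearBase hr) (isClosed_nearBase hr) c,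
    (isCompact_nearBase hr).of_isClosed_subset (isClosed_tsupport _)
      (tsupport_indicator_subset (isClosed_nearBase hr) c)⟩

lemma continuous_orbitPoint : Continuous fun p : F × F × Fˣ × maxCompact F × maxCompact F =>
    orbitPoint p.1 p.2.1 p.2.2.1 p.2.2.2.1 p.2.2.2.2 := by
  have hk₁ : Continuous fun p : F × F × Fˣ × maxCompact F × maxCompact F =>
      ((inclK p.2.2.2.1)⁻¹ : GL (Fin 2) F).val :=
    Units.continuous_val.comp (continuous_inv.comp (continuous_inclK.comp (by fun_prop)))
  have hk₂ : Continuous fun p : F × F × Fˣ × maxCompact F × maxCompact F =>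
      (inclK p.2.2.2.2 : GL (Fin 2) F).val :=
    Units.continuous_val.comp (continuous_inclK.comp (by fun_prop))
  have he : Continuous fun p : F × F × Fˣ × maxCompact F × maxCompact F => (p.2.2.1 : F) :=
    Units.continuous_val.comp (by fun_prop)
  have hei : Continuous fun p : F × F × Fˣ × maxCompact F × maxCompact F => (p.2.2.1 : F)⁻¹ :=
    he.inv₀ fun p => p.2.2.1.ne_zero
  have hA : Continuous fun p : F × F × Fˣ × maxCompact F × maxCompact F =>
      (!![(p.2.2.1 : F)⁻¹, (p.2.2.1 : F)⁻¹ * p.2.1; 0, 0] : Matrix (Fin 2) (Fin 2) F) := by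
    refine continuous_matrix fun i j => ?_
    fin_cases i <;> fin_cases j <;> simp <;> fun_prop
  have hB : Continuous fun p : F × F × Fˣ × maxCompact F × maxCompact F =>
      (!![0, -(p.1 * p.2.2.1); 0, (p.2.2.1 : F)] : Matrix (Fin 2) (Fin 2) F) := by
    refine continuous_matrix fun i j => ?_
    fin_cases i <;> fin_cases j <;> simp <;> fun_prop
  exact ((hk₁.matrix_mul hA).matrix_mul hk₂).prodMk ((hk₁.matrix_mul hB).matrix_mul hk₂)

lemma orbitPoint_one : orbitPoint (0 : F) 0 1 1 1 = basePoint F := by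
  simp [orbitPoint, basePoint]

lemma basePoint_mem_nearBase (r : NNReal) : basePoint F ∈ nearBase r := by
  simp [nearBase]

end NearBase

/-! ### The two-variable zeta integral of a bump function. -/

section Bump

variable {F : Type*} [Field F] [ValuativeRel F] [TopologicalSpace F]
  [IsNonarchimedeanLocalField F]
  {ψ : AddChar F Circle} {V₁ V₂ : Type*} [AddCommGroup V₁] [Module ℂ V₁] [AddCommGroup V₂]
  [Module ℂ V₂] {π₁ : Representation ℂ (GL (Fin 2) F) V₁} {π₂ : Representation ℂ (GL (Fin 2) F) V₂}
  {ω₁ ω₂ μ : Fˣ →* ℂˣ} {r : NNReal} {v₁ : V₁} {v₂ : V₂} {l₁ : V₁ →ₗ[ℂ] ℂ} {l₂ : V₂ →ₗ[ℂ] ℂ}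

/-- At an orbit point close to the base point, both inner integrands are translates of multiples of
the integrands of the zeta integrals, and the factors cancel. -/
lemma exists_inner_translates (hr : r < 1)
    (hl₁ : IsWhittakerFunctional π₁ ψ l₁) (hl₂ : IsWhittakerFunctional π₂ ψ l₂)
    (hω₁ : IsCentralCharacter π₁ ω₁) (hω₂ : IsCentralCharacter π₂ ω₂) (hω : ω₁ * ω₂ = 1)
    (hv₁ : IsFixed π₁ r v₁) (hv₂ : IsFixed π₂ r v₂)
    (hωr : ∀ z : Fˣ, normAbs ((z : F) - 1) ≤ r → ω₂ z = 1)
    (hμr : ∀ z : Fˣ, normAbs ((z : F) - 1) ≤ r → μ z = 1)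
    {u v : F} {e : Fˣ} {k₁ k₂ : maxCompact F} (h : orbitPoint u v e k₁ k₂ ∈ nearBase r)
    (s₁ s₂ : ℂ) :
    ∃ (t₁ t₂ : Fˣ) (C₁ C₂ : ℂ),
      (∀ a, innerIntegrand ψ (fun g => l₁ (π₁ g v₁)) μ s₁ u k₁ a =
        C₁ * zetaIntegrand (fun g => l₁ (π₁ g v₁)) μ s₁ (a * t₁)) ∧
      (∀ b, innerIntegrand ψ (fun g => l₂ (π₂ g v₂)) μ⁻¹ s₂ v k₂ b =
        C₂ * zetaIntegrand (fun g => l₂ (π₂ g v₂)) μ⁻¹ s₂ (b * t₂)) ∧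
      ∀ f, outerFactor f ω₂ μ s₂ u v e k₁ k₂ * C₁ * C₂ = f (orbitPoint u v e k₁ k₂) := by
  obtain ⟨⟨hc₁, hd₁, -, hq₁⟩, ⟨hc₂, hd₂, -, hq₂⟩, he, hed, hδ⟩ := orbitPoint_mem_nearBase hr h
  have hdet₁ := normAbs_det_inclK k₁
  have hdet₂ := normAbs_det_inclK k₂
  have hne : ∀ {x : F}, normAbs x = 1 → x ≠ 0 := fun {x} hx h0 => by
    rw [h0] at hx; simp at hx
  let d₁ := Units.mk0 _ (hne hd₁)
  let d₂ := Units.mk0 _ (hne hd₂)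
  let δ₁ := Units.mk0 _ (hne hdet₁)
  let δ₂ := Units.mk0 _ (hne hdet₂)
  let t₁ := δ₁ / d₁ ^ 2
  let t₂ := δ₂ / d₂ ^ 2
  have hin₁ := innerIntegrand_eq hv₁ hl₁ hω₁ μ (u := u) (k := k₁) (d := d₁) (t := t₁) rfl
    (by simp [t₁, δ₁, d₁]) hc₁ hd₁ hq₁ s₁
  have hin₂ := innerIntegrand_eq hv₂ hl₂ hω₂ μ⁻¹ (u := v) (k := k₂) (d := d₂) (t := t₂) rfl
    (by simp [t₂, δ₂, d₂]) hc₂ hd₂ hq₂ s₂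
  refine ⟨t₁, t₂, _, _, hin₁, hin₂, fun f => ?_⟩
  have hx : normAbs (((e * d₂ / d₁ : Fˣ) : F) - 1) ≤ r := by
    simpa [d₁, d₂] using hed
  have hy : normAbs (((δ₁ / δ₂ : Fˣ) : F) - 1) ≤ r := by
    simpa [δ₁, δ₂] using hδ
  have h1 : (ω₂ e : ℂ) * ω₂ d₂ = ω₂ d₁ := by
    have := hωr _ hx
    rw [map_div, map_mul, div_eq_one] at this
    exact_mod_cast this
  have h2 : (ω₁ d₁ : ℂ) * ω₂ d₁ = 1 := by
    have := DFunLike.congr_fun hω d₁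
    rw [MonoidHom.mul_apply, MonoidHom.one_apply] at this
    rw [← Units.val_mul, this, Units.val_one]
  have h3 : (μ e : ℂ) * μ d₂ = μ d₁ := by
    have := hμr _ hx
    rw [map_div, map_mul, div_eq_one] at this
    exact_mod_cast this
  have h4 : (μ δ₁ : ℂ) = μ δ₂ := by
    have := hμr _ hy
    rw [map_div, div_eq_one] at this
    exact_mod_cast this
  have hn : ∀ z : Fˣ, (μ z : ℂ) ≠ 0 := fun z => (μ z).ne_zero
  have he' := hn e
  have hd₁' := hn d₁
  have hd₂' := hn d₂
  have hδ₂' := hn δ₂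
  rw [outerFactor, absPow_eq_one he]
  simp only [t₁, t₂, map_div, map_pow, MonoidHom.inv_apply, Units.val_inv_eq_inv_val,
    Units.val_div_eq_div_val, Units.val_pow_eq_pow_val, h4, inv_div, mul_one]
  -- Since t₂/t₁ = (δ₂/δ₁)(d₁/d₂)², replacing μ(d₁) by μ(ε)μ(d₂) cancels μ(ε)⁻².
  rw [← h3]
  field_simp
  linear_combination (ω₁ d₁ : ℂ) * f (orbitPoint u v e k₁ k₂) * h1 + f (orbitPoint u v e k₁ k₂) * h2

/-- The set of parameters whose orbit point is close to the base point. -/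
def nearParam (r : NNReal) : Set (F × F × Fˣ × maxCompact F × maxCompact F) :=
  {p | orbitPoint p.1 p.2.1 p.2.2.1 p.2.2.2.1 p.2.2.2.2 ∈ nearBase r}

lemma isOpen_nearParam (hr0 : 0 < r) : IsOpen (nearParam (F := F) r) :=
  (isOpen_nearBase hr0).preimage continuous_orbitPoint

lemma continuous_innerIntegrand {V : Type*} [AddCommGroup V] [Module ℂ V]
    {π : Representation ℂ (GL (Fin 2) F) V}
    (hsm : ∀ v : V, ∃ U : OpenSubgroup (GL (Fin 2) F), v ∈ fixedVectors π U)
    (hψ : Continuous ψ) (l : V →ₗ[ℂ] ℂ) (w : V) {χ : Fˣ →* ℂˣ} (hχ : Continuous χ) (s : ℂ) :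
    Continuous fun p : F × maxCompact F × Fˣ =>
      innerIntegrand ψ (fun g => l (π g w)) χ s p.1 p.2.1 p.2.2 := by
  have hW : Continuous fun p : F × maxCompact F × Fˣ =>
      l (π (diagOne p.2.2 * inclK p.2.1) w) :=
    (continuous_whittaker hsm l w).comp ((continuous_diagOne.comp (by fun_prop)).mul
      (continuous_inclK.comp (by fun_prop)))
  have hψ' : Continuous fun p : F × maxCompact F × Fˣ => (ψ (p.1 * p.2.2) : ℂ) :=
    continuous_subtype_val.comp (hψ.comp (continuous_fst.mul (Units.continuous_val.comp (by fun_prop))))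
  have hχ' : Continuous fun p : F × maxCompact F × Fˣ => ((χ p.2.2 : ℂˣ) : ℂ) :=
    Units.continuous_val.comp (hχ.comp (by fun_prop))
  exact ((hW.mul hψ').mul hχ').mul ((continuous_absPow _).comp (by fun_prop))

variable [MeasurableSpace F] [BorelSpace F]

/-- The set is open and contains the parameters of the base point; the constraints |u|, |v| ≤ 1 and
|ε| = 1 put it in a compact set. Positivity of the real-valued measure also records finiteness. -/
lemma measure_nearParam_pos (dx : Measure F) [dx.IsAddHaarMeasure] (dm : Measure Fˣ)
    [dm.IsHaarMeasure] (dk : Measure (maxCompact F)) [dk.IsHaarMeasure] (hr0 : 0 < r) (hr : r < 1) :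
    0 < (dx.prod (dx.prod (dm.prod (dk.prod dk)))).real (nearParam r) := by
  have hp1 : (dk.prod dk).IsOpenPosMeasure := inferInstance
  have hp2 : (dm.prod (dk.prod dk)).IsOpenPosMeasure := inferInstance
  have hp3 : (dx.prod (dm.prod (dk.prod dk))).IsOpenPosMeasure := inferInstance
  have hp4 : (dx.prod (dx.prod (dm.prod (dk.prod dk)))).IsOpenPosMeasure := inferInstance
  have hcomp : IsCompact ((ball F 1 : Set F) ×ˢ (ball F 1 : Set F) ×ˢ
      {a : Fˣ | 1 ≤ normAbs (a : F) ∧ normAbs (a : F) ≤ 1} ×ˢ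
        (Set.univ : Set (maxCompact F)) ×ˢ (Set.univ : Set (maxCompact F))) :=
    (isCompact_ball 1).prod ((isCompact_ball 1).prod ((isCompact_annulus one_pos).prod
      (isCompact_univ.prod isCompact_univ)))
  have hsub : nearParam r ⊆ ((ball F 1 : Set F) ×ˢ (ball F 1 : Set F) ×ˢ
      {a : Fˣ | 1 ≤ normAbs (a : F) ∧ normAbs (a : F) ≤ 1} ×ˢ
        (Set.univ : Set (maxCompact F)) ×ˢ (Set.univ : Set (maxCompact F))) := by
    intro p hp
    obtain ⟨⟨-, -, hu, -⟩, ⟨-, -, hv, -⟩, he, -⟩ := orbitPoint_mem_nearBase hr hp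
    exact ⟨hu, hv, ⟨he.ge, he.le⟩, Set.mem_univ _, Set.mem_univ _⟩
  refine ENNReal.toReal_pos ?_ ((measure_mono hsub).trans_lt hcomp.measure_lt_top).ne
  refine ((isOpen_nearParam hr0).measure_pos _ ⟨(0, 0, 1, 1, 1), ?_⟩).ne'
  change orbitPoint 0 0 1 1 1 ∈ nearBase r
  rw [orbitPoint_one]
  exact basePoint_mem_nearBase r

/-- The zeta integral in two variables at a normalized bump function near the base point. -/
lemma zetaTwo_indicator_nearBase (dx : Measure F) [dx.IsAddHaarMeasure] (dm : Measure Fˣ)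
    [dm.IsHaarMeasure] (dk : Measure (maxCompact F)) [dk.IsHaarMeasure]
    (hsm₁ : ∀ v : V₁, ∃ U : OpenSubgroup (GL (Fin 2) F), v ∈ fixedVectors π₁ U)
    (hsm₂ : ∀ v : V₂, ∃ U : OpenSubgroup (GL (Fin 2) F), v ∈ fixedVectors π₂ U)
    (hψ : Continuous ψ) (hμ : Continuous μ) (hr0 : 0 < r) (hr : r < 1)
    (hl₁ : IsWhittakerFunctional π₁ ψ l₁) (hl₂ : IsWhittakerFunctional π₂ ψ l₂)
    (hω₁ : IsCentralCharacter π₁ ω₁) (hω₂ : IsCentralCharacter π₂ ω₂) (hω : ω₁ * ω₂ = 1)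
    (hv₁ : IsFixed π₁ r v₁) (hv₂ : IsFixed π₂ r v₂)
    (hωr : ∀ z : Fˣ, normAbs ((z : F) - 1) ≤ r → ω₂ z = 1)
    (hμr : ∀ z : Fˣ, normAbs ((z : F) - 1) ≤ r → μ z = 1)
    {s₁ s₂ : ℂ} (hz₁ : ZetaConverges dm (fun g => l₁ (π₁ g v₁)) μ s₁)
    (hz₂ : ZetaConverges dm (fun g => l₂ (π₂ g v₂)) μ⁻¹ s₂) (c : ℂ) :
    ZetaTwoConverges dx dm dk ψ ω₂ (fun g => l₁ (π₁ g v₁)) (fun g => l₂ (π₂ g v₂))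
      ((nearBase r).indicator fun _ => c) μ s₁ s₂ ∧
    zetaTwo dx dm dk ψ ω₂ (fun g => l₁ (π₁ g v₁)) (fun g => l₂ (π₂ g v₂))
      ((nearBase r).indicator fun _ => c) μ s₁ s₂ =
      (dx.prod (dx.prod (dm.prod (dk.prod dk)))).real (nearParam r) * c *
        (zeta dm (fun g => l₁ (π₁ g v₁)) μ s₁ * zeta dm (fun g => l₂ (π₂ g v₂)) μ⁻¹ s₂) := by
  set W₁ : GL (Fin 2) F → ℂ := fun g => l₁ (π₁ g v₁) with hW₁
  set W₂ : GL (Fin 2) F → ℂ := fun g => l₂ (π₂ g v₂) with hW₂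
  set f : Matrix (Fin 2) (Fin 2) F × Matrix (Fin 2) (Fin 2) F → ℂ :=
    (nearBase r).indicator fun _ => c with hf
  set P := dx.prod (dx.prod (dm.prod (dk.prod dk))) with hP
  have hmeas : MeasurableSet (nearParam (F := F) r) := (isOpen_nearParam hr0).measurableSet
  -- An infinite measure has real value 0, which positivity excludes.
  have hfin : P (nearParam r) ≠ ⊤ := fun h => by
    have := measure_nearParam_pos dx dm dk (F := F) hr0 hr
    rw [measureReal_def, ← hP, h] at this
    simp at this
  have hout : ∀ p ∉ nearParam r, outerFactor f ω₂ μ s₂ p.1 p.2.1 p.2.2.1 p.2.2.2.1 p.2.2.2.2 = 0 := by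
    intro p hp
    rw [outerFactor, hf, Set.indicator_of_notMem (show _ ∉ nearBase r from hp)]
    simp
  have hfp : ∀ p ∈ nearParam r, f (orbitPoint p.1 p.2.1 p.2.2.1 p.2.2.2.1 p.2.2.2.2) = c :=
    fun p hp => Set.indicator_of_mem (show _ ∈ nearBase r from hp) _
  constructor
  · have hcont : Continuous fun p : (F × F × Fˣ × maxCompact F × maxCompact F) × Fˣ × Fˣ =>
        outerFactor f ω₂ μ s₂ p.1.1 p.1.2.1 p.1.2.2.1 p.1.2.2.2.1 p.1.2.2.2.2 *
          innerIntegrand ψ W₁ μ s₁ p.1.1 p.1.2.2.2.1 p.2.1 *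
          innerIntegrand ψ W₂ μ⁻¹ s₂ p.1.2.1 p.1.2.2.2.2 p.2.2 := by
      have hμi : Continuous (μ⁻¹ : Fˣ →* ℂˣ) := hμ.inv
      -- A homomorphism trivial near 1 is continuous.
      have hωc : Continuous ω₂ := by
        refine continuous_of_continuousAt_one ω₂ ?_
        refine Filter.Tendsto.congr' ?_ (tendsto_const_nhds (x := ω₂ 1))
        have hs : {z : Fˣ | normAbs ((z : F) - 1) ≤ r} ∈ 𝓝 (1 : Fˣ) := by
          have h1 : Continuous fun z : Fˣ => (z : F) - 1 :=
            Units.continuous_val.sub continuous_const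
          exact ((isOpen_ball hr0).preimage h1).mem_nhds (by simp)
        filter_upwards [hs] with z hz
        rw [hωr z hz, map_one]
      have hfc : Continuous f := (isSchwartzBruhat_indicator_nearBase hr0 c).1.continuous
      have h1 : Continuous fun p : F × F × Fˣ × maxCompact F × maxCompact F =>
          outerFactor f ω₂ μ s₂ p.1 p.2.1 p.2.2.1 p.2.2.2.1 p.2.2.2.2 := by
        have he : Continuous fun p : F × F × Fˣ × maxCompact F × maxCompact F => p.2.2.1 := by
          fun_prop
        exact (((hfc.comp continuous_orbitPoint).mul
          (Units.continuous_val.comp (hωc.comp he))).mul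
            (Units.continuous_val.comp ((hμ.comp he).inv.pow 2))).mul ((continuous_absPow _).comp he)
      have h2 := (continuous_innerIntegrand hsm₁ hψ l₁ v₁ hμ s₁).comp
        (f := fun p : (F × F × Fˣ × maxCompact F × maxCompact F) × Fˣ × Fˣ =>
          (p.1.1, p.1.2.2.2.1, p.2.1)) (by fun_prop)
      have h3 := (continuous_innerIntegrand hsm₂ hψ l₂ v₂ hμi s₂).comp
        (f := fun p : (F × F × Fˣ × maxCompact F × maxCompact F) × Fˣ × Fˣ =>
          (p.1.2.1, p.1.2.2.2.2, p.2.2)) (by fun_prop)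
      exact ((h1.comp continuous_fst).mul h2).mul h3
    have hkey : ∀ p ∈ nearParam r, ∃ t₁ t₂ : Fˣ, ∀ q : Fˣ × Fˣ,
        outerFactor f ω₂ μ s₂ p.1 p.2.1 p.2.2.1 p.2.2.2.1 p.2.2.2.2 *
          innerIntegrand ψ W₁ μ s₁ p.1 p.2.2.2.1 q.1 *
          innerIntegrand ψ W₂ μ⁻¹ s₂ p.2.1 p.2.2.2.2 q.2 =
        c * (zetaIntegrand W₁ μ s₁ (q.1 * t₁) * zetaIntegrand W₂ μ⁻¹ s₂ (q.2 * t₂)) := by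
      intro p hp
      obtain ⟨t₁, t₂, C₁, C₂, h1, h2, h3⟩ := exists_inner_translates hr hl₁ hl₂ hω₁ hω₂ hω hv₁ hv₂
        hωr hμr hp s₁ s₂
      refine ⟨t₁, t₂, fun q => ?_⟩
      rw [h1, h2, ← hfp p hp, ← h3 f]
      ring
    change Integrable (fun p : (F × F × Fˣ × maxCompact F × maxCompact F) × Fˣ × Fˣ =>
        outerFactor f ω₂ μ s₂ p.1.1 p.1.2.1 p.1.2.2.1 p.1.2.2.2.1 p.1.2.2.2.2 *
          innerIntegrand ψ W₁ μ s₁ p.1.1 p.1.2.2.2.1 p.2.1 *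
          innerIntegrand ψ W₂ μ⁻¹ s₂ p.1.2.1 p.1.2.2.2.2 p.2.2) (P.prod (dm.prod dm))
    rw [integrable_prod_iff hcont.aestronglyMeasurable]
    constructor
    · refine Filter.Eventually.of_forall fun p => ?_
      by_cases hp : p ∈ nearParam r
      · obtain ⟨t₁, t₂, h⟩ := hkey p hp
        simp only [h]
        exact ((hz₁.comp_mul_right t₁).mul_prod (hz₂.comp_mul_right t₂)).const_mul c
      · simp only [hout p hp, zero_mul]
        exact integrable_zero _ _ _
    -- The translations t₁, t₂ vary with p, but they disappear under Haar integration, so the L¹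
    -- norm in the last two variables is constant on `nearParam r`.
    · have hnorm : (fun p : F × F × Fˣ × maxCompact F × maxCompact F => ∫ q : Fˣ × Fˣ,
          ‖outerFactor f ω₂ μ s₂ p.1 p.2.1 p.2.2.1 p.2.2.2.1 p.2.2.2.2 *
            innerIntegrand ψ W₁ μ s₁ p.1 p.2.2.2.1 q.1 *
            innerIntegrand ψ W₂ μ⁻¹ s₂ p.2.1 p.2.2.2.2 q.2‖ ∂(dm.prod dm)) =
          (nearParam r).indicator fun _ => ‖c‖ *
            ((∫ a, ‖zetaIntegrand W₁ μ s₁ a‖ ∂dm) * ∫ b, ‖zetaIntegrand W₂ μ⁻¹ s₂ b‖ ∂dm) := by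
        funext p
        by_cases hp : p ∈ nearParam r
        · obtain ⟨t₁, t₂, h⟩ := hkey p hp
          rw [Set.indicator_of_mem hp]
          simp only [h, norm_mul]
          rw [integral_const_mul,
            integral_prod_mul (fun a => ‖zetaIntegrand W₁ μ s₁ (a * t₁)‖)
              (fun b => ‖zetaIntegrand W₂ μ⁻¹ s₂ (b * t₂)‖),
            integral_mul_right_eq_self (fun a => ‖zetaIntegrand W₁ μ s₁ a‖) t₁,
            integral_mul_right_eq_self (fun a => ‖zetaIntegrand W₂ μ⁻¹ s₂ a‖) t₂]
        · rw [Set.indicator_of_notMem hp]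
          simp only [hout p hp, zero_mul, norm_zero, integral_zero]
      rw [hnorm]
      exact (integrable_indicator_iff hmeas).2 (integrableOn_const hfin)
  · have hint : (fun p : F × F × Fˣ × maxCompact F × maxCompact F =>
        outerFactor f ω₂ μ s₂ p.1 p.2.1 p.2.2.1 p.2.2.2.1 p.2.2.2.2 *
          (∫ a, innerIntegrand ψ W₁ μ s₁ p.1 p.2.2.2.1 a ∂dm) *
          (∫ b, innerIntegrand ψ W₂ μ⁻¹ s₂ p.2.1 p.2.2.2.2 b ∂dm)) =
        (nearParam r).indicator fun _ => c * (zeta dm W₁ μ s₁ * zeta dm W₂ μ⁻¹ s₂) := by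
      funext p
      by_cases hp : p ∈ nearParam r
      · obtain ⟨t₁, t₂, C₁, C₂, h1, h2, h3⟩ := exists_inner_translates hr hl₁ hl₂ hω₁ hω₂ hω hv₁ hv₂
          hωr hμr hp s₁ s₂
        rw [Set.indicator_of_mem hp]
        rw [funext h1, funext h2, integral_const_mul, integral_const_mul,
          integral_mul_right_eq_self (zetaIntegrand W₁ μ s₁) t₁,
          integral_mul_right_eq_self (zetaIntegrand W₂ μ⁻¹ s₂) t₂, ← hfp p hp, ← h3 f, zeta, zeta]
        ring
      · rw [Set.indicator_of_notMem hp]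
        simp only [hout p hp, zero_mul]
    change ∫ p : F × F × Fˣ × maxCompact F × maxCompact F,
        outerFactor f ω₂ μ s₂ p.1 p.2.1 p.2.2.1 p.2.2.2.1 p.2.2.2.2 *
          (∫ a, innerIntegrand ψ W₁ μ s₁ p.1 p.2.2.2.1 a ∂dm) *
          (∫ b, innerIntegrand ψ W₂ μ⁻¹ s₂ p.2.1 p.2.2.2.2 b ∂dm) ∂P = _
    rw [hint, integral_indicator hmeas, setIntegral_const, Complex.real_smul]
    ring

end Bump

/-! ### A Whittaker function supported near 1 on the torus. -/

section Compact

variable {F : Type*} [Field F] [ValuativeRel F] [TopologicalSpace F]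
  [IsNonarchimedeanLocalField F] {V : Type*} [AddCommGroup V] [Module ℂ V]
  {π : Representation ℂ (GL (Fin 2) F) V} {ψ : AddChar F Circle} {l : V →ₗ[ℂ] ℂ}

lemma nearOne_diagOne {r : NNReal} {a : Fˣ} (ha : normAbs ((a : F) - 1) ≤ r) :
    NearOne r (diagOne a) := by
  rw [nearOne_iff]; simp [ha]

/-- A weighted average over unipotent translates of `v` cuts the Whittaker function of `v` on the
diagonal down to the set of all `a` such that `ψ((a - 1) ·)` is trivial on `L`. -/
lemma IsFixed.whittaker_sum_upperRightHom {r : NNReal} {v : V} (h : IsFixed π r v)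
    (hl : IsWhittakerFunctional π ψ l) (hψr : ∀ x : F, normAbs x ≤ r → ψ x = 1)
    {L : AddSubgroup F} {X : Finset F} (hX : IsCosetReps X L (ball F r)) (a : Fˣ) :
    l (π (diagOne a) (∑ x ∈ X, (ψ (-x) : ℂ) • π (upperRightHom x) v)) =
      {a : Fˣ | ∀ y ∈ L, ψ (((a : F) - 1) * y) = 1}.indicator
        (fun a => X.card * l (π (diagOne a) v)) a := by
  have h1 : l (π (diagOne a) (∑ x ∈ X, (ψ (-x) : ℂ) • π (upperRightHom x) v)) =
      ∑ x ∈ X, (ψ (((a : F) - 1) * x) : ℂ) * l (π (diagOne a) v) := by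
    rw [map_sum, map_sum]
    refine Finset.sum_congr rfl fun x _ => ?_
    have h2 := hl.apply_diagOne_mul a x 1 v
    rw [mul_one, mul_one] at h2
    rw [map_smul, map_smul, smul_eq_mul, ← Module.End.mul_apply, ← map_mul π, h2, ← mul_assoc,
      ← Circle.coe_mul, ← AddChar.map_add_eq_mul]
    congr 3
    ring_nf
  rw [h1]
  by_cases ha : a ∈ {a : Fˣ | ∀ y ∈ L, ψ (((a : F) - 1) * y) = 1}
  · rw [Set.indicator_of_mem ha, Finset.sum_congr rfl (g := fun _ => l (π (diagOne a) v)),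
      Finset.sum_const, nsmul_eq_mul]
    intro x hx
    rw [ha x (hX.mem x hx), Circle.coe_one, one_mul]
  · rw [Set.indicator_of_notMem ha]
    simp only [Set.mem_ofPred_eq, not_forall] at ha
    obtain ⟨y, hy, hne⟩ := ha
    -- Where the Whittaker function is non-zero, ψ(a ·) and ψ are both trivial on the ball of radius
    -- r, so the terms descend to cosets.
    have hinv : ∀ x ∈ L, ∀ z ∈ ball F r,
        (ψ (((a : F) - 1) * (x + z)) : ℂ) * l (π (diagOne a) v) =
          (ψ (((a : F) - 1) * x) : ℂ) * l (π (diagOne a) v) := by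
      intro x _ z hz
      have h3 := h.whittaker_mul_eq hl a (mem_ball.1 hz)
      rw [show ((a : F) - 1) * (x + z) = ((a : F) - 1) * x + (-z + a * z) by ring,
        AddChar.map_add_eq_mul, AddChar.map_add_eq_mul,
        hψr (-z) (by rw [normAbs_neg]; exact hz), one_mul, Circle.coe_mul, mul_assoc, h3]
    -- Orthogonality of characters: translating by y multiplies the sum by ψ((a - 1)y) ≠ 1 yet
    -- leaves it unchanged, so it is zero.
    have h4 := hX.sum_add (f := fun x => (ψ (((a : F) - 1) * x) : ℂ) * l (π (diagOne a) v)) hinv hy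
    have h5 : ∑ x ∈ X, (ψ (((a : F) - 1) * (x + y)) : ℂ) * l (π (diagOne a) v) =
        ψ (((a : F) - 1) * y) * ∑ x ∈ X, (ψ (((a : F) - 1) * x) : ℂ) * l (π (diagOne a) v) := by
      rw [Finset.mul_sum]
      refine Finset.sum_congr rfl fun x _ => ?_
      rw [mul_add, AddChar.map_add_eq_mul, Circle.coe_mul]
      ring
    rw [h5] at h4
    by_contra h0
    refine hne (Circle.coe_injective ?_)
    rw [Circle.coe_one]
    exact mul_right_cancel₀ h0 (by rw [h4, one_mul])

/-- There is a vector for which all zeta integrals converge and are equal to one. -/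
lemma exists_zeta_eq_one [MeasurableSpace F] [BorelSpace F] (dm : Measure Fˣ) [dm.IsHaarMeasure]
    (hsm : ∀ v : V, ∃ U : OpenSubgroup (GL (Fin 2) F), v ∈ fixedVectors π U)
    (hψ : Continuous ψ) (hψ1 : ψ ≠ 1) (hl : IsWhittakerFunctional π ψ l) (hl0 : l ≠ 0)
    {μ : Fˣ →* ℂˣ} (hμ : Continuous μ) :
    ∃ w : V, ∀ s : ℂ, ZetaConverges dm (fun g => l (π g w)) μ s ∧
      zeta dm (fun g => l (π g w)) μ s = 1 := by
  obtain ⟨v, hv⟩ : ∃ v, l v ≠ 0 := by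
    by_contra! h
    exact hl0 (LinearMap.ext h)
  obtain ⟨y₀, hy₀⟩ := (AddChar.ne_one_iff).1 hψ1
  obtain ⟨r₁, hr₁, hr₁', hfix₁⟩ := exists_isFixed hsm v
  obtain ⟨r₂, hr₂, hr₂'⟩ := exists_addChar_eq_one hψ
  obtain ⟨r₃, hr₃, hr₃'⟩ := exists_char_eq_one hμ
  obtain ⟨r, hr0, hrr₁, hrr₂, hrr₃⟩ : ∃ r : NNReal, 0 < r ∧ r ≤ r₁ ∧ r ≤ r₂ ∧ r ≤ r₃ :=
    ⟨min r₁ (min r₂ r₃), by simp [hr₁, hr₂, hr₃], by simp, by simp, by simp⟩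
  have hr1 : r < 1 := hrr₁.trans_lt hr₁'
  have hr0' : (0 : ℝ) < r := hr0
  have hfix := hfix₁.mono hrr₁
  have hψr : ∀ x : F, normAbs x ≤ r → ψ x = 1 := fun x hx =>
    hr₂' x (hx.trans (by exact_mod_cast hrr₂))
  have hμr : ∀ x : Fˣ, normAbs ((x : F) - 1) ≤ r → μ x = 1 := fun x hx =>
    hr₃' x (hx.trans (by exact_mod_cast hrr₃))
  -- This radius makes y₀/(a - 1) available as a test point once |a - 1| > r, so every a in `D`
  -- satisfies |a - 1| ≤ r.
  let R : NNReal := ⟨normAbs y₀, normAbs_nonneg _⟩ / r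
  have hR : (R : ℝ) = normAbs y₀ / r := rfl
  obtain ⟨X, hX⟩ := exists_isCosetReps (isCompact_ball (F := F) R) (isOpen_ball (F := F) hr0)
  let D : Set Fˣ := {a : Fˣ | ∀ y ∈ ball F R, ψ (((a : F) - 1) * y) = 1}
  have hDr : ∀ a ∈ D, normAbs ((a : F) - 1) ≤ r := by
    intro a ha
    by_contra! hlt
    have hpos : 0 < normAbs ((a : F) - 1) := hr0'.trans hlt
    have hne : (a : F) - 1 ≠ 0 := fun h0 => by rw [h0] at hpos; simp at hpos
    refine hy₀ ?_
    rw [← ha (y₀ / ((a : F) - 1)) ?_, mul_div_cancel₀ _ hne]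
    rw [mem_ball, normAbs_div, hR]
    exact div_le_div_of_nonneg_left (normAbs_nonneg _) hr0' hlt.le
  have hDclosed : IsClosed D := by
    have : D = ⋂ y ∈ ball F R, {a : Fˣ | ψ (((a : F) - 1) * y) = 1} := by
      ext a; simp [D]
    rw [this]
    refine isClosed_biInter fun y _ => isClosed_eq (hψ.comp ?_) continuous_const
    exact (Units.continuous_val.sub continuous_const).mul continuous_const
  have hDfin : dm D < ⊤ := by
    refine (measure_mono fun a ha => ?_).trans_lt
      (isCompact_annulus (F := F) (c := 1) (C := 1) one_pos).measure_lt_top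
    have := normAbs_eq_one_of_sub_one_le hr1 (hDr a ha)
    exact ⟨this.ge, this.le⟩
  have hDpos : dm D ≠ 0 := by
    have hcont : Continuous fun a : Fˣ => (a : F) - 1 := Units.continuous_val.sub continuous_const
    have hR1 : 0 < R + 1 := by positivity
    -- `D` contains all a with |a - 1| ≤ r/(R + 1), since then (a - 1)y has absolute value at most r
    -- for y in the ball of radius R.
    refine ((((isOpen_ball (F := F) (r := r / (R + 1)) (by positivity)).preimage hcont).measure_pos
      dm ⟨1, by simp⟩).trans_le (measure_mono (t := D) fun a ha y hy => hψr _ ?_)).ne'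
    have ha' : normAbs ((a : F) - 1) ≤ (r / (R + 1) : NNReal) := ha
    refine (normAbs_mul_le ha' (mem_ball.1 hy)).trans ?_
    rw [← NNReal.coe_mul, NNReal.coe_le_coe, div_mul_eq_mul_div, div_le_iff₀ hR1]
    exact mul_le_mul_of_nonneg_left (by simp) hr0.le
  let w₀ : V := ∑ x ∈ X, (ψ (-x) : ℂ) • π (upperRightHom x) v
  let N : ℂ := dm.real D * (X.card * l v)
  have hN : N ≠ 0 := by
    refine mul_ne_zero ?_ (mul_ne_zero (by exact_mod_cast hX.nonempty.card_pos.ne') hv)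
    exact_mod_cast (ENNReal.toReal_pos hDpos hDfin.ne).ne'
  have hW : ∀ s : ℂ, zetaIntegrand (fun g => l (π g (N⁻¹ • w₀))) μ s =
      D.indicator fun _ => N⁻¹ * (X.card * l v) := by
    intro s
    funext a
    have h1 := hfix.whittaker_sum_upperRightHom hl hψr hX a
    rw [zetaIntegrand, map_smul, map_smul, smul_eq_mul]
    by_cases ha : a ∈ D
    · rw [Set.indicator_of_mem ha] at h1 ⊢
      -- On `D` the vector v is fixed by diag(a, 1), while μ and |·| are 1, so s drops out.
      rw [h1, hfix _ (nearOne_diagOne (hDr a ha)), hμr a (hDr a ha),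
        absPow_eq_one (normAbs_eq_one_of_sub_one_le hr1 (hDr a ha)), Units.val_one, mul_one, mul_one]
    · rw [Set.indicator_of_notMem ha] at h1 ⊢
      rw [h1, mul_zero, zero_mul, zero_mul]
  refine ⟨N⁻¹ • w₀, fun s => ⟨?_, ?_⟩⟩
  · rw [ZetaConverges, hW]
    exact (integrable_indicator_iff hDclosed.measurableSet).2 (integrableOn_const hDfin.ne)
  · rw [zeta, hW, integral_indicator hDclosed.measurableSet, setIntegral_const, Complex.real_smul]
    calc _ = N⁻¹ * N := by simp only [N]; ring
      _ = 1 := inv_mul_cancel₀ hN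

end Compact

end GLTwoZeta

end

/-! ### Assembly of (a) and (b). -/

theorem mainTheorem7 {F : Type*} [Field F] [ValuativeRel F] [TopologicalSpace F]
    [IsNonarchimedeanLocalField F] [MeasurableSpace F] [BorelSpace F]
    (dx : Measure F) [dx.IsAddHaarMeasure]
    (dm : Measure Fˣ) [dm.IsHaarMeasure]
    (dk : Measure (GLTwoZeta.maxCompact F)) [dk.IsHaarMeasure]
    (ψ : AddChar F Circle) (hψ : Continuous ψ) (hψ1 : ψ ≠ 1)
    {V₁ V₂ : Type*} [AddCommGroup V₁] [Module ℂ V₁] [AddCommGroup V₂] [Module ℂ V₂]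
    (π₁ : Representation ℂ (GL (Fin 2) F) V₁) (π₂ : Representation ℂ (GL (Fin 2) F) V₂)
    (hπ₁ : GLTwoZeta.IsIrredAdmissible π₁) (hπ₂ : GLTwoZeta.IsIrredAdmissible π₂)
    (hgen₁ : GLTwoZeta.IsGeneric π₁ ψ) (hgen₂ : GLTwoZeta.IsGeneric π₂ ψ)
    (ω₁ ω₂ : Fˣ →* ℂˣ) (hω₁ : GLTwoZeta.IsCentralCharacter π₁ ω₁)
    (hω₂ : GLTwoZeta.IsCentralCharacter π₂ ω₂) (hω : ω₁ * ω₂ = 1)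
    (μ : Fˣ →* ℂˣ) (hμ : Continuous μ) :
    (∀ W₁ ∈ GLTwoZeta.whittakerModel π₁ ψ, ∀ W₂ ∈ GLTwoZeta.whittakerModel π₂ ψ,
      (∃ σ : ℝ, ∀ s : ℂ, σ < s.re →
        GLTwoZeta.ZetaConverges dm W₁ μ s ∧ GLTwoZeta.ZetaConverges dm W₂ μ⁻¹ s) ∧
      ∀ U ∈ 𝓝 (GLTwoZeta.basePoint F),
        ∃ f : Matrix (Fin 2) (Fin 2) F × Matrix (Fin 2) (Fin 2) F → ℂ,
          GLTwoZeta.IsSchwartzBruhat f ∧ tsupport f ⊆ U ∧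
          ∀ s₁ s₂ : ℂ,
            GLTwoZeta.ZetaConverges dm W₁ μ s₁ → GLTwoZeta.ZetaConverges dm W₂ μ⁻¹ s₂ →
              GLTwoZeta.ZetaTwoConverges dx dm dk ψ ω₂ W₁ W₂ f μ s₁ s₂ ∧
              GLTwoZeta.zetaTwo dx dm dk ψ ω₂ W₁ W₂ f μ s₁ s₂ =
                GLTwoZeta.zeta dm W₁ μ s₁ * GLTwoZeta.zeta dm W₂ μ⁻¹ s₂) ∧
    (∃ W₁ ∈ GLTwoZeta.whittakerModel π₁ ψ, ∃ W₂ ∈ GLTwoZeta.whittakerModel π₂ ψ,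
      ∃ f : Matrix (Fin 2) (Fin 2) F × Matrix (Fin 2) (Fin 2) F → ℂ,
        GLTwoZeta.IsSchwartzBruhat f ∧
        ∀ s₁ s₂ : ℂ,
          GLTwoZeta.ZetaTwoConverges dx dm dk ψ ω₂ W₁ W₂ f μ s₁ s₂ ∧
          GLTwoZeta.zetaTwo dx dm dk ψ ω₂ W₁ W₂ f μ s₁ s₂ = 1) := by
  have hμi : Continuous (μ⁻¹ : Fˣ →* ℂˣ) := hμ.inv
  obtain ⟨m₁, hm₁0, hm₁⟩ := hgen₁
  obtain ⟨m₂, hm₂0, hm₂⟩ := hgen₂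
  have hnear : ∀ W₁ ∈ GLTwoZeta.whittakerModel π₁ ψ, ∀ W₂ ∈ GLTwoZeta.whittakerModel π₂ ψ,
      ∀ U ∈ 𝓝 (GLTwoZeta.basePoint F),
        ∃ f : Matrix (Fin 2) (Fin 2) F × Matrix (Fin 2) (Fin 2) F → ℂ,
          GLTwoZeta.IsSchwartzBruhat f ∧ tsupport f ⊆ U ∧
          ∀ s₁ s₂ : ℂ,
            GLTwoZeta.ZetaConverges dm W₁ μ s₁ → GLTwoZeta.ZetaConverges dm W₂ μ⁻¹ s₂ →
              GLTwoZeta.ZetaTwoConverges dx dm dk ψ ω₂ W₁ W₂ f μ s₁ s₂ ∧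
              GLTwoZeta.zetaTwo dx dm dk ψ ω₂ W₁ W₂ f μ s₁ s₂ =
                GLTwoZeta.zeta dm W₁ μ s₁ * GLTwoZeta.zeta dm W₂ μ⁻¹ s₂ := by
    rintro _ ⟨l₁, v₁, hl₁, rfl⟩ _ ⟨l₂, v₂, hl₂, rfl⟩ U hU
    -- The vector v₂ may be zero, so triviality of ω₂ near 1 is read off from another, non-zero
    -- vector.
    obtain ⟨x, hx⟩ : ∃ x, m₂ x ≠ 0 := by
      by_contra! h
      exact hm₂0 (LinearMap.ext h)
    have hx0 : x ≠ 0 := fun h0 => hx (by rw [h0, map_zero])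
    obtain ⟨r₁, hr₁, hr₁', hfix₁⟩ := GLTwoZeta.exists_isFixed hπ₁.smooth v₁
    obtain ⟨r₂, hr₂, -, hfix₂⟩ := GLTwoZeta.exists_isFixed hπ₂.smooth v₂
    obtain ⟨r₃, hr₃, -, hfix₃⟩ := GLTwoZeta.exists_isFixed hπ₂.smooth x
    obtain ⟨r₄, hr₄, hμr⟩ := GLTwoZeta.exists_char_eq_one hμ
    obtain ⟨r₅, hr₅, hUr⟩ := GLTwoZeta.exists_nearBase_subset hU
    obtain ⟨r, hr0, h₁, h₂, h₃, h₄, h₅⟩ :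
        ∃ r : NNReal, 0 < r ∧ r ≤ r₁ ∧ r ≤ r₂ ∧ r ≤ r₃ ∧ r ≤ r₄ ∧ r ≤ r₅ :=
      ⟨min r₁ (min r₂ (min r₃ (min r₄ r₅))), by simp [hr₁, hr₂, hr₃, hr₄, hr₅], by simp, by simp,
        by simp, by simp, by simp⟩
    have hr1 : r < 1 := h₁.trans_lt hr₁'
    have hpos := GLTwoZeta.measure_nearParam_pos dx dm dk hr0 hr1
    refine ⟨(GLTwoZeta.nearBase r).indicator fun _ =>
        (((dx.prod (dx.prod (dm.prod (dk.prod dk)))).real (GLTwoZeta.nearParam r) : ℝ) : ℂ)⁻¹,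
      GLTwoZeta.isSchwartzBruhat_indicator_nearBase hr0 _,
      ((GLTwoZeta.tsupport_indicator_subset (GLTwoZeta.isClosed_nearBase hr0) _).trans
        (GLTwoZeta.nearBase_mono h₅)).trans hUr, fun s₁ s₂ hz₁ hz₂ => ?_⟩
    have key := GLTwoZeta.zetaTwo_indicator_nearBase dx dm dk hπ₁.smooth hπ₂.smooth hψ hμ hr0 hr1
      hl₁ hl₂ hω₁ hω₂ hω (hfix₁.mono h₁) (hfix₂.mono h₂)
      (fun z hz => (hfix₃.mono h₃).centralCharacter_eq_one hx0 hω₂ hz)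
      (fun z hz => hμr z (hz.trans (by exact_mod_cast h₄))) hz₁ hz₂
      (((dx.prod (dx.prod (dm.prod (dk.prod dk)))).real (GLTwoZeta.nearParam r) : ℝ) : ℂ)⁻¹
    refine ⟨key.1, key.2.trans ?_⟩
    rw [mul_inv_cancel₀ (by exact_mod_cast hpos.ne'), one_mul]
  refine ⟨fun W₁ hW₁ W₂ hW₂ => ⟨?_, hnear W₁ hW₁ W₂ hW₂⟩, ?_⟩
  · obtain ⟨l₁, v₁, hl₁, rfl⟩ := hW₁
    obtain ⟨l₂, v₂, hl₂, rfl⟩ := hW₂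
    obtain ⟨σ₁, h₁⟩ := GLTwoZeta.exists_zetaConverges dm hπ₁.smooth hπ₁.admissible hψ hψ1 hl₁ hμ v₁
    obtain ⟨σ₂, h₂⟩ := GLTwoZeta.exists_zetaConverges dm hπ₂.smooth hπ₂.admissible hψ hψ1 hl₂ hμi v₂
    exact ⟨max σ₁ σ₂, fun s hs => ⟨h₁ s ((le_max_left _ _).trans_lt hs),
      h₂ s ((le_max_right _ _).trans_lt hs)⟩⟩
  · obtain ⟨w₁, hw₁⟩ := GLTwoZeta.exists_zeta_eq_one dm hπ₁.smooth hψ hψ1 hm₁ hm₁0 hμ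
    obtain ⟨w₂, hw₂⟩ := GLTwoZeta.exists_zeta_eq_one dm hπ₂.smooth hψ hψ1 hm₂ hm₂0 hμi
    have hW₁ : (fun g => m₁ (π₁ g w₁)) ∈ GLTwoZeta.whittakerModel π₁ ψ := ⟨m₁, w₁, hm₁, rfl⟩
    have hW₂ : (fun g => m₂ (π₂ g w₂)) ∈ GLTwoZeta.whittakerModel π₂ ψ := ⟨m₂, w₂, hm₂, rfl⟩
    obtain ⟨f, hf, -, h⟩ := hnear _ hW₁ _ hW₂ Set.univ Filter.univ_mem
    refine ⟨_, hW₁, _, hW₂, f, hf, fun s₁ s₂ => ?_⟩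
    obtain ⟨h1, h2⟩ := h s₁ s₂ (hw₁ s₁).1 (hw₂ s₂).1
    exact ⟨h1, by rw [h2, (hw₁ s₁).2, (hw₂ s₂).2, mul_one]⟩
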